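/- Setting. Multigraphs are finite and undirected and may have parallel edges and self-loops; a self-loop at $v$ contributes $2$ to the degree $d(v)$. For $k\colon V\to\mathbb R$, a weak $k(v)$-orientation of a multigraph is an orientation of its edges in which every node $v$ has outdegree at least $k(v)$ (an oriented self-loop contributes $1$ to the outdegree). We use the deterministic $\mathsf{LOCAL}$ model on multigraphs: the edge ends at a node $v$ are numbered by ports $0,\dots,d(v)-1$; nodes have distinct identifiers of $O(\log n)$ bits, i.e. in $\{0,\dots,n^c-1\}$ for a fixed constant $c\ge 1$; every node initially knows the number of nodes $n$, an upper bound $\Delta$ on the maximum degree, its identifier and its degree; in each synchronous round every node sends a message of arbitrary size along each of its incident edge ends, receives the messages sent to it, and does arbitrary local computation; at the end every node outputs the orientation of its incident edges. An algorithm computes an orientation of a given kind in time $T(n,\Delta)$ if on every $n$-node multigraph of maximum degree at most $\Delta$, for all port numberings and all identifier assignments, the outputs after $T(n,\Delta)$ rounds form such an orientation. Lemma. For every identifier constant $c\ge 1$ there is a constant $C>0$, depending only on $c$, such that the following holds. Let $0<\varepsilon_2<\varepsilon_1\le \frac16$, where $\varepsilon_1,\varepsilon_2$ may depend on $n$ and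 $\Delta$, and let $T(n,\Delta)\ge \log n$ (natural logarithm, for $n\ge 1$). Assume that there is a deterministic algorithm $\mathcal A$ that computes a weak $\bigl((\frac12-\varepsilon_1)d(v)-2\bigr)$-orientation in time $T(n,\Delta)$. Then there is a deterministic algorithm $\mathcal B$ that computes a weak $\bigl((\frac12-\varepsilon_2)d(v)-2\bigr)$-orientation in time $T'(n,\Delta)$, where for all $n$ and $\Delta$ $$T'(n,\Delta)\le C\,\varepsilon_2^{\,1/\log_2(\frac12+\varepsilon_1)}\,T(n,\Delta)\qquad\text{and}\qquad T'(n,\Delta)\le C\,\varepsilon_2^{-(1+24\varepsilon_1)}\,T(n,\Delta).$$ -/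

import Mathlib

/-- A multigraph (parallel edges and self-loops allowed) on the node set `V` together with a port
numbering: the half-edges at a node `v` are `⟨v, 0⟩, …, ⟨v, deg v - 1⟩`, and `conn` sends each
half-edge to the other half of the same edge. So an edge is a pair `{h, conn h}`, a self-loop at `v`
is an edge both of whose halves lie at `v`, and a self-loop contributes two to `deg v`. -/
structure PortNetwork (V : Type) where
  /-- the degree of a node -/
  deg : V → ℕ
  /-- the other half of an edge -/
  conn : (Σ v : V, Fin (deg v)) → Σ v : V, Fin (deg v)
  conn_conn : ∀ h, conn (conn h) = h
  conn_ne : ∀ h, conn h ≠ h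

namespace PortNetwork

variable {V : Type}

/-- The half-edges of a multigraph. -/
abbrev HalfEdge (N : PortNetwork V) : Type := Σ v : V, Fin (N.deg v)

/-- An orientation of the edges, recorded by marking each half-edge as outgoing (`true`) or incoming
(`false`): an edge that is outgoing at one of its two halves is incoming at the other one. -/
def IsOrientation (N : PortNetwork V) (out : N.HalfEdge → Bool) : Prop :=
  ∀ h, out (N.conn h) = !(out h)

/-- The number of edges that leave `v`; an oriented self-loop at `v` is counted once. -/
def outdeg (N : PortNetwork V) (out : N.HalfEdge → Bool) (v : V) : ℕ :=
  (Finset.univ.filter fun i : Fin (N.deg v) => out ⟨v, i⟩ = true).card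

/-- A weak `k(v)`-orientation: every node `v` has outdegree at least `k v`. -/
def IsWeakOrientation (N : PortNetwork V) (k : V → ℝ) (out : N.HalfEdge → Bool) : Prop :=
  N.IsOrientation out ∧ ∀ v, k v ≤ (N.outdeg out v : ℝ)

end PortNetwork

/-- A deterministic algorithm of the LOCAL model, in which every node outputs an orientation of its
incident edges. Local computation and message size are unbounded. A node initially knows the number
`n` of nodes, the bound `Δ` on the maximum degree, its own identifier and its own degree. In each
synchronous round, a node of degree `d` sends one message through each of its ports `0, …, d - 1`
and updates its state with the messages that arrive through its ports. -/
structure LocalAlgorithm where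
  /-- the states of a node -/
  State : Type
  /-- the messages -/
  Msg : Type
  /-- `init n Δ x d` is the initial state of a node with identifier `x` and degree `d` -/
  init : ℕ → ℕ → ℕ → ℕ → State
  /-- `send d s i` is the message sent through port `i` in state `s` -/
  send : (d : ℕ) → State → Fin d → Msg
  /-- `step d s m` is the new state when message `m i` arrives through port `i` in state `s` -/
  step : (d : ℕ) → State → (Fin d → Msg) → State
  /-- `out d s i` tells whether the edge at port `i` is outgoing -/
  out : (d : ℕ) → State → Fin d → Bool

namespace LocalAlgorithm

variable {V : Type}

/-- The state of each node after the given number of rounds, when the algorithm is run on the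
multigraph `N` with the identifiers `ident`. -/
def state (A : LocalAlgorithm) (n Δ : ℕ) (N : PortNetwork V) (ident : V → ℕ) :
    ℕ → V → A.State
  | 0, v => A.init n Δ (ident v) (N.deg v)
  | t + 1, v =>
      A.step (N.deg v) (A.state n Δ N ident t v) fun i =>
        A.send (N.deg (N.conn ⟨v, i⟩).1) (A.state n Δ N ident t (N.conn ⟨v, i⟩).1)
          (N.conn ⟨v, i⟩).2

/-- The output of all nodes after `t` rounds, as a marking of the half-edges. -/
def output (A : LocalAlgorithm) (n Δ : ℕ) (N : PortNetwork V) (ident : V → ℕ) (t : ℕ)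
    (h : N.HalfEdge) : Bool :=
  A.out (N.deg h.1) (A.state n Δ N ident t h.1) h.2

/-- `A` computes a weak `k n Δ (d(v))`-orientation in time `T n Δ`: on every multigraph with `n` nodes
and maximum degree at most `Δ`, for every port numbering and every assignment of distinct
identifiers of at most `c * log₂ n` bits (identifiers from `{0, …, n ^ c - 1}`), the outputs after
`T n Δ` rounds form such an orientation. -/
def ComputesWeakOrientation (A : LocalAlgorithm) (c : ℕ) (k : ℕ → ℕ → ℕ → ℝ) (T : ℕ → ℕ → ℕ) :
    Prop :=
  ∀ (n Δ : ℕ) (N : PortNetwork (Fin n)) (ident : Fin n → ℕ),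
    Function.Injective ident → (∀ v, ident v < n ^ c) → (∀ v, N.deg v ≤ Δ) →
      N.IsWeakOrientation (fun v => k n Δ (N.deg v)) (A.output n Δ N ident (T n Δ))

end LocalAlgorithm

/-! The mechanism is degree halving. Given any orientation, each node arranges its outgoing ports in
pairs, and the two edges of a pair are glued into one edge that bypasses the node. An edge is
outgoing at only one half, so glued paths have at most two edges, and one step in the contracted
network costs at most two steps in the original. An orientation of the contracted network lifts by
orienting each path consistently, and each pair then contributes exactly one outgoing edge. So
paired ports are split perfectly, and a node can only lose on the ports left over (`outdeg_unhalve`,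
`LocallySolvable.halve`).

With the orientation from the given algorithm, the excess of the degree over 9 shrinks by the factor
`1/2 + ε₁` in each contraction, while the running time roughly doubles (`exists_iterate_halve`).
After about `log ε₂ / log (1/2 + ε₁)` contractions, a remaining degree of at least 10 costs at most
`ε₂ d`. Nodes whose remaining degree is at most 9 need outdegree `⌊d/3⌋`, which keeps their loss at
2 (`le_outdeg_of_iterate_halve`).

That base case is a sinkless orientation problem: ports are grouped in triples and each full triple
needs an outgoing port. Within logarithmic distance of each triple there is a partial orientation in
which every triple that is entered is also left (`exists_closed_set`). When each edge obeys the
first such closed set containing it, every full triple is satisfied (`exists_out_of_isFullTriple`).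

Algorithms are treated as functions of views, so that rules can be composed without simulating
messages; `exists_algorithm_of_locallySolvable` turns the result back into an algorithm. -/

/-! ### Views and local rules -/

/-- The views of radius `t` around `v` in `N` and around `v'` in `N'` agree. -/
def ViewEq {V : Type} (N N' : PortNetwork V) (ident ident' : V → ℕ) : ℕ → V → V → Prop
  | 0, v, v' => ident v = ident' v' ∧ N.deg v = N'.deg v'
  | t + 1, v, v' => ViewEq N N' ident ident' t v v' ∧
      ∀ (i : Fin (N.deg v)) (i' : Fin (N'.deg v')), i.val = i'.val →
        (N.conn ⟨v, i⟩).2.val = (N'.conn ⟨v', i'⟩).2.val ∧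
          ViewEq N N' ident ident' t (N.conn ⟨v, i⟩).1 (N'.conn ⟨v', i'⟩).1

namespace ViewEq

variable {V : Type} {N N' : PortNetwork V} {ident ident' : V → ℕ}

theorem mono {s t : ℕ} (hst : s ≤ t) {v v' : V} (h : ViewEq N N' ident ident' t v v') :
    ViewEq N N' ident ident' s v v' := by
  induction t with
  | zero => obtain rfl : s = 0 := by omega
            exact h
  | succ t ih =>
    rcases Nat.lt_or_ge t s with h1 | h1
    · obtain rfl : s = t + 1 := by omega
      exact h
    · exact ih h1 h.1

theorem ident_eq {t : ℕ} {v v' : V} (h : ViewEq N N' ident ident' t v v') : ident v = ident' v' :=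
  (h.mono (Nat.zero_le t)).1

theorem deg_eq {t : ℕ} {v v' : V} (h : ViewEq N N' ident ident' t v v') : N.deg v = N'.deg v' :=
  (h.mono (Nat.zero_le t)).2

theorem symm {t : ℕ} {v v' : V} (h : ViewEq N N' ident ident' t v v') :
    ViewEq N' N ident' ident t v' v := by
  induction t generalizing v v' with
  | zero => exact ⟨h.1.symm, h.2.symm⟩
  | succ t ih =>
    exact ⟨ih h.1, fun i i' hi => ⟨(h.2 i' i hi.symm).1.symm, ih (h.2 i' i hi.symm).2⟩⟩

end ViewEq

theorem Fin.exists_val_eq {a b : ℕ} (h : a = b) (i : Fin a) : ∃ j : Fin b, i.val = j.val :=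
  ⟨Fin.cast h i, rfl⟩

theorem Fin.fun_agree {α : Type*} {φ : (d : ℕ) → Fin d → α} {d d' : ℕ} (h : d = d') {i : Fin d}
    {i' : Fin d'} (hi : i.val = i'.val) : φ d i = φ d' i' := by
  subst h
  rw [Fin.ext hi]

/-- The networks and identifiers that an algorithm has to handle. -/
structure Admissible (c : ℕ) {n : ℕ} (Δ : ℕ) (N : PortNetwork (Fin n)) (ident : Fin n → ℕ) :
    Prop where
  injective : Function.Injective ident
  ident_lt : ∀ v, ident v < n ^ c
  deg_le : ∀ v, N.deg v ≤ Δ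

/-- A rule that orients the edges of all networks on `Fin n`. -/
abbrev OrientationRule (n : ℕ) : Type :=
  (N : PortNetwork (Fin n)) → (Fin n → ℕ) → N.HalfEdge → Bool

/-- The orientation of the edges at a node depends only on its view of radius `R`. -/
def OrientationRule.IsLocal {n : ℕ} (F : OrientationRule n) (c Δ R : ℕ) : Prop :=
  ∀ (N N' : PortNetwork (Fin n)) (ident ident' : Fin n → ℕ) (v v' : Fin n),
    Admissible c Δ N ident → Admissible c Δ N' ident' → ViewEq N N' ident ident' R v v' →
      ∀ (i : Fin (N.deg v)) (i' : Fin (N'.deg v')), i.val = i'.val →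
        F N ident ⟨v, i⟩ = F N' ident' ⟨v', i'⟩

/-- Orientations in which degree and outdegree of each node are related by `P` can be found by a
rule of locality `R`. -/
def LocallySolvable (c n Δ R : ℕ) (P : ℕ → ℕ → Prop) : Prop :=
  ∃ F : OrientationRule n, F.IsLocal c Δ R ∧ ∀ N ident, Admissible c Δ N ident →
    N.IsOrientation (F N ident) ∧ ∀ v, P (N.deg v) (N.outdeg (F N ident) v)

theorem LocallySolvable.imp {c n Δ R : ℕ} {P Q : ℕ → ℕ → Prop} (h : LocallySolvable c n Δ R P)
    (hPQ : ∀ d o, P d o → Q d o) : LocallySolvable c n Δ R Q := by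
  obtain ⟨F, hF, hF'⟩ := h
  exact ⟨F, hF, fun N ident ha => ⟨(hF' N ident ha).1, fun v => hPQ _ _ ((hF' N ident ha).2 v)⟩⟩

namespace LocalAlgorithm

theorem step_agree (A : LocalAlgorithm) {d d' : ℕ} (h : d = d') {s s' : A.State} (hs : s = s')
    {m : Fin d → A.Msg} {m' : Fin d' → A.Msg}
    (hm : ∀ (i : Fin d) (i' : Fin d'), i.val = i'.val → m i = m' i') :
    A.step d s m = A.step d' s' m' := by
  subst h hs
  congr 1
  funext i
  exact hm i i rfl

theorem state_eq_of_viewEq (A : LocalAlgorithm) {V : Type} (n Δ : ℕ) {N N' : PortNetwork V}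
    {ident ident' : V → ℕ} {t : ℕ} {v v' : V} (h : ViewEq N N' ident ident' t v v') :
    A.state n Δ N ident t v = A.state n Δ N' ident' t v' := by
  induction t generalizing v v' with
  | zero => simp only [state, h.ident_eq, h.deg_eq]
  | succ t ih =>
    simp only [state]
    refine A.step_agree h.deg_eq (ih h.1) fun i i' hi => ?_
    obtain ⟨h1, h2⟩ := h.2 i i' hi
    rw [ih h2]
    exact Fin.fun_agree (φ := fun d i => A.send d _ i) h2.deg_eq h1

theorem ComputesWeakOrientation.locallySolvable {A : LocalAlgorithm} {c : ℕ} {k : ℕ → ℕ → ℕ → ℝ}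
    {T : ℕ → ℕ → ℕ} (h : A.ComputesWeakOrientation c k T) (n Δ : ℕ) :
    LocallySolvable c n Δ (T n Δ) fun d o => k n Δ d ≤ o := by
  refine ⟨fun N ident => A.output n Δ N ident (T n Δ), ?_, fun N ident ha =>
    h n Δ N ident ha.injective ha.ident_lt ha.deg_le⟩
  intro N N' ident ident' v v' _ _ hv i i' hi
  simp only [output]
  rw [A.state_eq_of_viewEq n Δ hv]
  exact Fin.fun_agree (φ := fun d i => A.out d _ i) hv.deg_eq hi

end LocalAlgorithm

/-! ### From local rules back to message passing -/

/-- What a node can learn: its initial knowledge, extended in each round by what its neighbours knew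
and by the ports through which they sent it. -/
inductive View : Type
  | init (n Δ x d : ℕ) : View
  | step (s : View) (d : ℕ) (nb : Fin d → View) (port : Fin d → ℕ) : View

namespace View

/-- The parameters of the network on which a view was collected. -/
def params : View → ℕ × ℕ
  | init n Δ _ _ => (n, Δ)
  | step s _ _ _ => s.params

theorem agree_of_step_eq {s s' : View} {d d' : ℕ} {nb : Fin d → View} {nb' : Fin d' → View}
    {port : Fin d → ℕ} {port' : Fin d' → ℕ} (h : step s d nb port = step s' d' nb' port') :
    s = s' ∧ ∀ (i : Fin d) (i' : Fin d'), i.val = i'.val → port i = port' i' ∧ nb i = nb' i' := by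
  cases h
  refine ⟨rfl, fun i i' hi => ?_⟩
  rw [Fin.ext hi]
  exact ⟨rfl, rfl⟩

end View

/-- The view of radius `t` of a node. -/
def collectedView {V : Type} (n Δ : ℕ) (N : PortNetwork V) (ident : V → ℕ) : ℕ → V → View
  | 0, v => View.init n Δ (ident v) (N.deg v)
  | t + 1, v => View.step (collectedView n Δ N ident t v) (N.deg v)
      (fun i => collectedView n Δ N ident t (N.conn ⟨v, i⟩).1)
      (fun i => (N.conn ⟨v, i⟩).2.val)

theorem collectedView_params {V : Type} (n Δ : ℕ) (N : PortNetwork V) (ident : V → ℕ) (t : ℕ)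
    (v : V) : (collectedView n Δ N ident t v).params = (n, Δ) := by
  induction t with
  | zero => rfl
  | succ t ih => exact ih

theorem viewEq_of_collectedView_eq {V : Type} {n Δ : ℕ} {N N' : PortNetwork V}
    {ident ident' : V → ℕ} {t : ℕ} {v v' : V}
    (h : collectedView n Δ N ident t v = collectedView n Δ N' ident' t v') :
    ViewEq N N' ident ident' t v v' := by
  induction t generalizing v v' with
  | zero =>
    simp only [collectedView, View.init.injEq] at h
    exact ⟨h.2.2.1, h.2.2.2⟩
  | succ t ih =>
    obtain ⟨h1, h2⟩ := View.agree_of_step_eq h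
    exact ⟨ih h1, fun i i' hi => ⟨(h2 i i' hi).1, ih (h2 i i' hi).2⟩⟩

open Classical in
/-- The algorithm that collects views of radius `R n Δ` and then applies the rule `F n Δ`. -/
noncomputable def viewAlgorithm (c : ℕ) (F : (n Δ : ℕ) → OrientationRule n)
    (R : ℕ → ℕ → ℕ) : LocalAlgorithm where
  State := View
  Msg := View × ℕ
  init := View.init
  send _ s i := (s, i.val)
  step d s m := View.step s d (fun i => (m i).1) (fun i => (m i).2)
  out _ s i := decide (∃ (n Δ : ℕ) (N : PortNetwork (Fin n)) (ident : Fin n → ℕ) (v : Fin n)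
    (j : Fin (N.deg v)), Admissible c Δ N ident ∧ collectedView n Δ N ident (R n Δ) v = s ∧
      j.val = i.val ∧ F n Δ N ident ⟨v, j⟩ = true)

theorem viewAlgorithm_state (c : ℕ) (F : (n Δ : ℕ) → OrientationRule n) (R : ℕ → ℕ → ℕ)
    {V : Type} (n Δ : ℕ) (N : PortNetwork V) (ident : V → ℕ) (t : ℕ) (v : V) :
    (viewAlgorithm c F R).state n Δ N ident t v = collectedView n Δ N ident t v := by
  induction t generalizing v with
  | zero => rfl
  | succ t ih =>
    simp only [LocalAlgorithm.state, ih]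
    rfl

/-- The existential in the output is harmless: a view records `n` and `Δ`, so every witness is an
instance with the same parameters, and by locality all admissible instances with this view give the
same answer. -/
theorem viewAlgorithm_output {c : ℕ} {F : (n Δ : ℕ) → OrientationRule n} {R : ℕ → ℕ → ℕ}
    (hF : ∀ n Δ, (F n Δ).IsLocal c Δ (R n Δ)) {n Δ : ℕ} {N : PortNetwork (Fin n)}
    {ident : Fin n → ℕ} (ha : Admissible c Δ N ident) :
    (viewAlgorithm c F R).output n Δ N ident (R n Δ) = F n Δ N ident := by
  funext ⟨v, i⟩
  simp only [LocalAlgorithm.output, viewAlgorithm_state]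
  rw [Bool.eq_iff_iff]
  simp only [viewAlgorithm, decide_eq_true_eq]
  constructor
  · rintro ⟨n', Δ', N', ident', v', j, ha', hs, hj, h⟩
    have hp := congrArg View.params hs
    simp only [collectedView_params, Prod.mk.injEq] at hp
    obtain ⟨rfl, rfl⟩ := hp
    rw [← h]
    exact (hF _ _ _ _ _ _ _ _ ha' ha (viewEq_of_collectedView_eq hs) j i hj).symm
  · exact fun h => ⟨n, Δ, N, ident, v, i, ha, rfl, rfl, h⟩

theorem exists_algorithm_of_locallySolvable {c : ℕ} {R : ℕ → ℕ → ℕ} {k : ℕ → ℕ → ℕ → ℝ}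
    (h : ∀ n Δ, LocallySolvable c n Δ (R n Δ) fun d o => k n Δ d ≤ o) :
    ∃ B : LocalAlgorithm, B.ComputesWeakOrientation c k R := by
  choose F hF hF' using h
  refine ⟨viewAlgorithm c F R, fun n Δ N ident h1 h2 h3 => ?_⟩
  rw [viewAlgorithm_output hF ⟨h1, h2, h3⟩]
  exact hF' n Δ N ident ⟨h1, h2, h3⟩

/-! ### Pairing the outgoing ports of a node -/

/-- A partial matching is encoded as an involution whose fixed points are the unmatched elements.
Matching two elements at a time leaves at most one element of `s` unmatched. -/
theorem exists_pairing {α : Type*} [DecidableEq α] (s : Finset α) :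
    ∃ m : α → α, (∀ x, m (m x) = x) ∧ (∀ x, m x ≠ x → x ∈ s) ∧
      (s.filter fun x => m x ≠ x).card = 2 * (s.card / 2) := by
  induction s using Finset.strongInduction with
  | H s ih =>
    rcases Nat.lt_or_ge s.card 2 with h | h
    · refine ⟨id, fun _ => rfl, fun x hx => absurd rfl hx, ?_⟩
      simp only [id, ne_eq, not_true_eq_false, Finset.filter_false, Finset.card_empty]
      omega
    · obtain ⟨a, ha, b, hb, hab⟩ := Finset.one_lt_card.1 h
      have hbe : b ∈ s.erase a := Finset.mem_erase.2 ⟨hab.symm, hb⟩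
      have hcard : ((s.erase a).erase b).card + 2 = s.card := by
        rw [← Finset.card_erase_add_one ha, ← Finset.card_erase_add_one hbe]
      obtain ⟨m, h1, h2, h3⟩ := ih ((s.erase a).erase b)
        ((Finset.erase_ssubset hbe).trans (Finset.erase_ssubset ha))
      have hma : m a = a := by
        by_contra h
        simpa using h2 a h
      have hmb : m b = b := by
        by_contra h
        simpa using h2 b h
      have hne : ∀ x, x ≠ a → x ≠ b → m x ≠ a ∧ m x ≠ b := fun x hxa hxb =>
        ⟨fun h => hxa (by rw [← h1 x, h, hma]), fun h => hxb (by rw [← h1 x, h, hmb])⟩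
      refine ⟨fun x => if x = a then b else if x = b then a else m x, fun x => ?_, fun x hx => ?_,
        ?_⟩
      · by_cases hxa : x = a
        · simp [hxa, hab.symm]
        · by_cases hxb : x = b
          · simp [hxb, hab.symm]
          · simp [hxa, hxb, hne x hxa hxb, h1]
      · by_cases hxa : x = a
        · exact hxa ▸ ha
        · by_cases hxb : x = b
          · exact hxb ▸ hb
          · simp only [hxa, hxb, if_false] at hx
            exact Finset.mem_of_mem_erase (Finset.mem_of_mem_erase (h2 x hx))
      · have hset : (s.filter fun x => (if x = a then b else if x = b then a else m x) ≠ x) =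
            insert a (insert b (((s.erase a).erase b).filter fun x => m x ≠ x)) := by
          ext x
          by_cases hxa : x = a
          · simp [hxa, hab.symm, ha]
          · by_cases hxb : x = b
            · simp [hxb, hab.symm, hab, hb]
            · simp [hxa, hxb]
        rw [hset, Finset.card_insert_of_notMem (by simp [hab]),
          Finset.card_insert_of_notMem (by simp), h3]
        omega

/-- A node whose outgoing ports are given by `w` arranges as many of them as possible in pairs; the
other ports are fixed. -/
noncomputable def portMate (d : ℕ) (w : Fin d → Bool) : Fin d → Fin d :=
  (exists_pairing (Finset.univ.filter fun i => w i = true)).choose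

section portMate

variable {d : ℕ} (w : Fin d → Bool)

theorem portMate_portMate (i : Fin d) : portMate d w (portMate d w i) = i :=
  (exists_pairing (Finset.univ.filter fun i => w i = true)).choose_spec.1 i

theorem out_of_portMate_ne {i : Fin d} (h : portMate d w i ≠ i) : w i = true :=
  (Finset.mem_filter.1 ((exists_pairing
    (Finset.univ.filter fun i => w i = true)).choose_spec.2.1 i h)).2

theorem card_portMate_ne : (Finset.univ.filter fun i => portMate d w i ≠ i).card =
    2 * ((Finset.univ.filter fun i => w i = true).card / 2) := by
  rw [← (exists_pairing (Finset.univ.filter fun i => w i = true)).choose_spec.2.2]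
  congr 1
  ext i
  simp only [Finset.mem_filter, Finset.mem_univ, true_and]
  exact ⟨fun h => ⟨out_of_portMate_ne w h, h⟩, fun h => h.2⟩

end portMate

/-- The number of ports without a mate. -/
noncomputable def freeDeg (d : ℕ) (w : Fin d → Bool) : ℕ :=
  Fintype.card {i : Fin d // portMate d w i = i}

/-- A numbering of the ports without a mate. -/
noncomputable def freePort (d : ℕ) (w : Fin d → Bool) :
    Fin (freeDeg d w) ≃ {i : Fin d // portMate d w i = i} :=
  (Fintype.equivFin _).symm

theorem freeDeg_eq (d : ℕ) (w : Fin d → Bool) :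
    freeDeg d w = d - 2 * ((Finset.univ.filter fun i => w i = true).card / 2) := by
  have h := Finset.card_filter_add_card_filter_not (s := (Finset.univ : Finset (Fin d)))
    (fun i => portMate d w i = i)
  rw [card_portMate_ne, Finset.card_univ, Fintype.card_fin] at h
  rw [freeDeg, Fintype.card_subtype]
  omega

section agree

variable {d d' : ℕ} {w : Fin d → Bool} {w' : Fin d' → Bool}

/-- The pairing is chosen as a function of the degree and the marking alone, so nodes that see the
same data make the same choice. This is what makes the contraction local. Ports are compared by
value because the degrees are only propositionally equal. -/
theorem portMate_agree (hd : d = d') (hw : ∀ i i', i.val = i'.val → w i = w' i') {i : Fin d}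
    {i' : Fin d'} (hi : i.val = i'.val) : (portMate d w i).val = (portMate d' w' i').val := by
  subst hd
  obtain rfl : w = w' := funext fun i => hw i i rfl
  rw [Fin.ext hi]

theorem freeDeg_agree (hd : d = d') (hw : ∀ i i', i.val = i'.val → w i = w' i') :
    freeDeg d w = freeDeg d' w' := by
  subst hd
  obtain rfl : w = w' := funext fun i => hw i i rfl
  rfl

theorem freePort_agree (hd : d = d') (hw : ∀ i i', i.val = i'.val → w i = w' i')
    {i : Fin (freeDeg d w)} {i' : Fin (freeDeg d' w')} (hi : i.val = i'.val) :
    (freePort d w i).1.val = (freePort d' w' i').1.val := by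
  subst hd
  obtain rfl : w = w' := funext fun i => hw i i rfl
  rw [Fin.ext hi]

theorem freePort_symm_agree (hd : d = d') (hw : ∀ i i', i.val = i'.val → w i = w' i')
    {i : {i : Fin d // portMate d w i = i}} {i' : {i : Fin d' // portMate d' w' i = i}}
    (hi : i.1.val = i'.1.val) :
    ((freePort d w).symm i).val = ((freePort d' w').symm i').val := by
  subst hd
  obtain rfl : w = w' := funext fun i => hw i i rfl
  rw [Subtype.ext (Fin.ext hi)]

end agree

/-! ### Contracting paired edges and lifting orientations -/

namespace PortNetwork

variable {V : Type} (N : PortNetwork V) (out : N.HalfEdge → Bool)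

/-- The half-edge that is paired with `h`, or `h` itself. -/
noncomputable def mate (h : N.HalfEdge) : N.HalfEdge :=
  ⟨h.1, portMate (N.deg h.1) (fun i => out ⟨h.1, i⟩) h.2⟩

theorem mate_mk_eq_iff {v : V} {i : Fin (N.deg v)} :
    N.mate out ⟨v, i⟩ = ⟨v, i⟩ ↔ portMate (N.deg v) (fun i => out ⟨v, i⟩) i = i := by
  simp [mate]

theorem mate_mate (h : N.HalfEdge) : N.mate out (N.mate out h) = h := by
  obtain ⟨v, i⟩ := h
  simp only [mate, portMate_portMate]

variable {N out}

theorem out_of_mate_ne {h : N.HalfEdge} (hh : N.mate out h ≠ h) : out h = true := by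
  obtain ⟨v, i⟩ := h
  rw [Ne, mate_mk_eq_iff] at hh
  exact out_of_portMate_ne (fun i => out ⟨v, i⟩) hh

theorem mate_mate_ne {h : N.HalfEdge} (hh : N.mate out h ≠ h) :
    N.mate out (N.mate out h) ≠ N.mate out h := by
  rw [mate_mate]
  exact hh.symm

/-- Only outgoing halves are paired and the opposite half is incoming. Hence no edge is glued at
both ends, and glued paths have at most two edges. -/
theorem IsOrientation.mate_conn (ho : N.IsOrientation out) {h : N.HalfEdge}
    (hh : N.mate out h ≠ h) : N.mate out (N.conn h) = N.conn h := by
  by_contra hc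
  have h1 := out_of_mate_ne hc
  rw [ho h, out_of_mate_ne hh] at h1
  simp at h1

variable (N out)

open Classical in
/-- The other end of the path that starts at `h`, if edges with paired halves are concatenated. -/
noncomputable def far (h : N.HalfEdge) : N.HalfEdge :=
  if N.mate out (N.conn h) = N.conn h then N.conn h else N.conn (N.mate out (N.conn h))

variable {N out}

theorem IsOrientation.mate_far (ho : N.IsOrientation out) (h : N.HalfEdge) :
    N.mate out (N.far out h) = N.far out h := by
  unfold far
  split_ifs with hc
  · exact hc
  · exact ho.mate_conn (mate_mate_ne hc)

theorem far_far {h : N.HalfEdge} (hh : N.mate out h = h) : N.far out (N.far out h) = h := by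
  by_cases hc : N.mate out (N.conn h) = N.conn h
  · have : N.far out h = N.conn h := if_pos hc
    rw [this, far, if_pos (by rw [N.conn_conn, hh]), N.conn_conn]
  · have : N.far out h = N.conn (N.mate out (N.conn h)) := if_neg hc
    rw [this, far, if_neg (by rw [N.conn_conn]; exact mate_mate_ne hc), N.conn_conn, mate_mate,
      N.conn_conn]

theorem far_ne (h : N.HalfEdge) : N.far out h ≠ h := by
  unfold far
  split_ifs with hc
  · exact N.conn_ne h
  · intro h1
    apply hc
    nth_rewrite 2 [← h1]
    rw [N.conn_conn]

variable (N out)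

/-- The half-edges without a mate, numbered at each node. -/
noncomputable def freeEquiv :
    (Σ v : V, Fin (freeDeg (N.deg v) fun i => out ⟨v, i⟩)) ≃
      {h : N.HalfEdge // N.mate out h = h} where
  toFun h := ⟨⟨h.1, (freePort _ _ h.2).1⟩, (N.mate_mk_eq_iff out).2 (freePort _ _ h.2).2⟩
  invFun h := ⟨h.1.1, (freePort _ _).symm ⟨h.1.2, (N.mate_mk_eq_iff out).1 h.2⟩⟩
  left_inv h := by simp
  right_inv h := by simp

/-- The network in which two edges whose outgoing halves are paired become one edge. -/
noncomputable abbrev halve (ho : N.IsOrientation out) : PortNetwork V where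
  deg v := freeDeg (N.deg v) fun i => out ⟨v, i⟩
  conn h := (N.freeEquiv out).symm ⟨N.far out (N.freeEquiv out h).1, ho.mate_far _⟩
  conn_conn h := by
    simp [far_far (N.freeEquiv out h).2]
  conn_ne h hh := by
    rw [Equiv.symm_apply_eq, Subtype.ext_iff] at hh
    exact far_ne _ hh

open Classical in
/-- The orientation of `N` that orients each path of `N.halve out` consistently. -/
noncomputable def unhalve (out' : (Σ v : V, Fin (freeDeg (N.deg v) fun i => out ⟨v, i⟩)) → Bool)
    (h : N.HalfEdge) : Bool :=
  if hh : N.mate out h = h then out' ((N.freeEquiv out).symm ⟨h, hh⟩)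
  else if hc : N.mate out (N.conn h) = N.conn h then
    !out' ((N.freeEquiv out).symm ⟨N.conn h, hc⟩)
  -- Unreachable when `out` is an orientation, since an edge then has at most one paired half.
  else false

variable {N out}

section unhalve

variable {ho : N.IsOrientation out} {out' : (N.halve out ho).HalfEdge → Bool}

theorem unhalve_of_mate_eq {h : N.HalfEdge} (hh : N.mate out h = h) :
    N.unhalve out out' h = out' ((N.freeEquiv out).symm ⟨h, hh⟩) :=
  dif_pos hh

theorem unhalve_of_mate_ne {h : N.HalfEdge} (hh : N.mate out h ≠ h) :
    N.unhalve out out' h = !N.unhalve out out' (N.conn h) := by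
  rw [unhalve_of_mate_eq (ho := ho) (ho.mate_conn hh)]
  exact (dif_neg hh).trans (dif_pos (ho.mate_conn hh))

theorem unhalve_far (ho' : (N.halve out ho).IsOrientation out') {h : N.HalfEdge}
    (hh : N.mate out h = h) :
    N.unhalve out out' (N.far out h) = !N.unhalve out out' h := by
  rw [unhalve_of_mate_eq hh, unhalve_of_mate_eq (ho.mate_far h)]
  have h1 := ho' ((N.freeEquiv out).symm ⟨h, hh⟩)
  rw [← h1]
  simp

theorem isOrientation_unhalve (ho' : (N.halve out ho).IsOrientation out') :
    N.IsOrientation (N.unhalve out out') := by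
  intro h
  by_cases hh : N.mate out h = h
  · by_cases hc : N.mate out (N.conn h) = N.conn h
    · have := unhalve_far ho' hh
      rwa [far, if_pos hc] at this
    · rw [unhalve_of_mate_ne (ho := ho) hc, N.conn_conn]
  · rw [unhalve_of_mate_ne (ho := ho) hh, Bool.not_not]

/-- The far ends of the two glued edges are the two ends of a single contracted edge and so carry
opposite marks; reversing along both edges keeps the marks opposite. -/
theorem unhalve_mate (ho' : (N.halve out ho).IsOrientation out') {h : N.HalfEdge}
    (hh : N.mate out h ≠ h) :
    N.unhalve out out' (N.mate out h) = !N.unhalve out out' h := by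
  rw [unhalve_of_mate_ne (ho := ho) hh, unhalve_of_mate_ne (ho := ho) (mate_mate_ne hh),
    ← unhalve_far ho' (ho.mate_conn hh), far, N.conn_conn, if_neg hh]

/-- Free ports are counted by the contracted network. On the paired ports the mate map swaps
outgoing and incoming, so exactly half of them are outgoing. -/
theorem outdeg_unhalve (ho' : (N.halve out ho).IsOrientation out') (v : V) :
    N.outdeg (N.unhalve out out') v =
      (N.halve out ho).outdeg out' v + N.outdeg out v / 2 := by
  classical
  set w : Fin (N.deg v) → Bool := fun i => out ⟨v, i⟩ with hw
  set p : Fin (N.deg v) → Bool := fun i => N.unhalve out out' ⟨v, i⟩ with hp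
  have hfree : (Finset.univ.filter fun i => p i = true ∧ portMate _ w i = i).card =
      (N.halve out ho).outdeg out' v := by
    symm
    refine Finset.card_bij (fun i _ => (freePort (N.deg v) w i).1) ?_ ?_ ?_
    · intro i hi
      have h1 := (Finset.mem_filter.1 hi).2
      have h2 := (freePort (N.deg v) w i).2
      refine Finset.mem_filter.2 ⟨Finset.mem_univ _, ?_, h2⟩
      rw [← h1, hp]
      dsimp only
      rw [unhalve_of_mate_eq (ho := ho) ((N.mate_mk_eq_iff out).2 h2)]
      exact congrArg out' ((Equiv.symm_apply_eq _).2 rfl)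
    · intro i _ j _ hij
      exact (freePort (N.deg v) w).injective (Subtype.ext hij)
    · intro i hi
      obtain ⟨-, h1, h2⟩ := Finset.mem_filter.1 hi
      refine ⟨(freePort (N.deg v) w).symm ⟨i, h2⟩, Finset.mem_filter.2 ⟨Finset.mem_univ _, ?_⟩,
        by simp⟩
      rw [← h1, hp]
      dsimp only
      rw [unhalve_of_mate_eq (ho := ho) ((N.mate_mk_eq_iff out).2 h2)]
      rfl
  have hflip : ∀ i, portMate _ w i ≠ i → p (portMate _ w i) = !p i := fun i hi =>
    unhalve_mate (h := ⟨v, i⟩) ho' fun h => hi ((N.mate_mk_eq_iff out).1 h)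
  have hpair : (Finset.univ.filter fun i => p i = true ∧ portMate _ w i ≠ i).card =
      (Finset.univ.filter fun i => ¬p i = true ∧ portMate _ w i ≠ i).card := by
    refine Finset.card_nbij' (portMate _ w) (portMate _ w) ?_ ?_ ?_ ?_
    · intro i hi
      have hi := (Finset.mem_filter.1 hi).2
      simp [hflip i hi.2, hi.1, portMate_portMate, hi.2.symm]
    · intro i hi
      have hi := (Finset.mem_filter.1 hi).2
      simp [hflip i hi.2, hi.1, portMate_portMate, hi.2.symm]
    · exact fun i _ => portMate_portMate w i
    · exact fun i _ => portMate_portMate w i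
  have h1 := card_portMate_ne w
  have h2 := Finset.card_filter_add_card_filter_not
    (s := Finset.univ.filter fun i => portMate _ w i ≠ i) (fun i => p i = true)
  have h3 := Finset.card_filter_add_card_filter_not
    (s := Finset.univ.filter fun i => p i = true) (fun i => portMate _ w i = i)
  simp only [Finset.filter_filter] at h2 h3
  simp only [and_comm (a := ¬portMate _ w _ = _)] at h2
  change (Finset.univ.filter fun i => p i = true).card = _ +
    (Finset.univ.filter fun i => w i = true).card / 2
  simp only [ne_eq] at *
  omega

end unhalve

end PortNetwork

/-! ### Locality of contraction and lifting -/

section locality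

variable {n c Δ T : ℕ} {F : OrientationRule n} {N N' : PortNetwork (Fin n)}
  {ident ident' : Fin n → ℕ}

theorem Admissible.halve (ha : Admissible c Δ N ident) {out : N.HalfEdge → Bool}
    (ho : N.IsOrientation out) : Admissible c Δ (N.halve out ho) ident where
  injective := ha.injective
  ident_lt := ha.ident_lt
  deg_le v := by
    refine le_trans ?_ (ha.deg_le v)
    rw [show (N.halve out ho).deg v = _ from freeDeg_eq (N.deg v) fun i => out ⟨v, i⟩]
    exact Nat.sub_le _ _

theorem mate_eq_iff_of_viewEq (hF : F.IsLocal c Δ T) (ha : Admissible c Δ N ident)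
    (ha' : Admissible c Δ N' ident') {v v' : Fin n} (h : ViewEq N N' ident ident' T v v')
    {i : Fin (N.deg v)} {i' : Fin (N'.deg v')} (hi : i.val = i'.val) :
    N.mate (F N ident) ⟨v, i⟩ = ⟨v, i⟩ ↔ N'.mate (F N' ident') ⟨v', i'⟩ = ⟨v', i'⟩ := by
  rw [PortNetwork.mate_mk_eq_iff, PortNetwork.mate_mk_eq_iff, Fin.ext_iff, Fin.ext_iff,
    portMate_agree h.deg_eq (hF N N' ident ident' v v' ha ha' h) hi, hi]

theorem far_of_viewEq (hF : F.IsLocal c Δ T) (ha : Admissible c Δ N ident)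
    (ha' : Admissible c Δ N' ident') {v v' : Fin n} {t : ℕ} (ht : T ≤ t)
    (h : ViewEq N N' ident ident' (t + 2) v v')
    {i : Fin (N.deg v)} {i' : Fin (N'.deg v')} (hi : i.val = i'.val) :
    (N.far (F N ident) ⟨v, i⟩).2.val = (N'.far (F N' ident') ⟨v', i'⟩).2.val ∧
      ViewEq N N' ident ident' t (N.far (F N ident) ⟨v, i⟩).1
        (N'.far (F N' ident') ⟨v', i'⟩).1 := by
  obtain ⟨h1, h2⟩ := h.2 i i' hi
  have hm := mate_eq_iff_of_viewEq hF ha ha' (h2.mono (by omega)) h1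
  unfold PortNetwork.far
  by_cases hc : N.mate (F N ident) (N.conn ⟨v, i⟩) = N.conn ⟨v, i⟩
  · rw [if_pos hc, if_pos (hm.1 hc)]
    exact ⟨h1, h2.mono (by omega)⟩
  · rw [if_neg hc, if_neg (fun h => hc (hm.2 h))]
    exact h2.2 _ _ (portMate_agree h2.deg_eq
      (hF N N' ident ident' _ _ ha ha' (h2.mono (by omega))) h1)

/-- Each contracted step consumes two original steps, and radius `T` must remain at the node reached
so that its pairing is determined. -/
theorem viewEq_halve (hF : F.IsLocal c Δ T) (ha : Admissible c Δ N ident)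
    (ha' : Admissible c Δ N' ident') (ho : N.IsOrientation (F N ident))
    (ho' : N'.IsOrientation (F N' ident')) (t : ℕ) {v v' : Fin n}
    (h : ViewEq N N' ident ident' (2 * t + T) v v') :
    ViewEq (N.halve _ ho) (N'.halve _ ho') ident ident' t v v' := by
  induction t generalizing v v' with
  | zero =>
    exact ⟨h.ident_eq, freeDeg_agree h.deg_eq
      (hF N N' ident ident' v v' ha ha' (h.mono (by omega)))⟩
  | succ t ih =>
    refine ⟨ih (h.mono (by omega)), fun i i' hi => ?_⟩
    have hp := freePort_agree h.deg_eq
      (hF N N' ident ident' v v' ha ha' (h.mono (by omega))) hi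
    obtain ⟨h1, h2⟩ := far_of_viewEq (t := 2 * t + T) hF ha ha' (by omega)
      (h.mono (by omega)) hp
    exact ⟨freePort_symm_agree h2.deg_eq
      (hF N N' ident ident' _ _ ha ha' (h2.mono (by omega))) h1, ih h2⟩

/-- The additional step serves paired halves, whose mark is read off from the other end of the edge.
-/
theorem unhalve_of_viewEq (hF : F.IsLocal c Δ T) {G : OrientationRule n} {R : ℕ}
    (hG : G.IsLocal c Δ R) (ha : Admissible c Δ N ident)
    (ha' : Admissible c Δ N' ident') (ho : N.IsOrientation (F N ident))
    (ho' : N'.IsOrientation (F N' ident')) {v v' : Fin n}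
    (h : ViewEq N N' ident ident' (2 * R + T + 1) v v')
    {i : Fin (N.deg v)} {i' : Fin (N'.deg v')} (hi : i.val = i'.val) :
    N.unhalve (F N ident) (G (N.halve _ ho) ident) ⟨v, i⟩ =
      N'.unhalve (F N' ident') (G (N'.halve _ ho') ident') ⟨v', i'⟩ := by
  have key : ∀ {u u' : Fin n} (_ : ViewEq N N' ident ident' (2 * R + T) u u')
      {j : Fin (N.deg u)} {j' : Fin (N'.deg u')} (_ : j.val = j'.val)
      (hj : N.mate (F N ident) ⟨u, j⟩ = ⟨u, j⟩),
      N.unhalve (F N ident) (G (N.halve _ ho) ident) ⟨u, j⟩ =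
        N'.unhalve (F N' ident') (G (N'.halve _ ho') ident') ⟨u', j'⟩ := by
    intro u u' hu j j' hjj hj
    have hj' := (mate_eq_iff_of_viewEq hF ha ha' (hu.mono (by omega)) hjj).1 hj
    rw [PortNetwork.unhalve_of_mate_eq (ho := ho) hj, PortNetwork.unhalve_of_mate_eq (ho := ho') hj']
    exact hG _ _ _ _ _ _ (ha.halve ho) (ha'.halve ho') (viewEq_halve hF ha ha' ho ho' R hu) _ _
      (freePort_symm_agree hu.deg_eq (hF N N' ident ident' _ _ ha ha' (hu.mono (by omega))) hjj)
  have hm := mate_eq_iff_of_viewEq hF ha ha' (h.mono (by omega)) hi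
  by_cases hc : N.mate (F N ident) ⟨v, i⟩ = ⟨v, i⟩
  · exact key (h.mono (by omega)) hi hc
  · rw [PortNetwork.unhalve_of_mate_ne (ho := ho) hc,
      PortNetwork.unhalve_of_mate_ne (ho := ho') (fun h => hc (hm.2 h)),
      key (h.2 i i' hi).2 (h.2 i i' hi).1 (ho.mate_conn hc)]

end locality

theorem LocallySolvable.halve {c n Δ T R : ℕ} {P Q : ℕ → ℕ → Prop}
    (hP : LocallySolvable c n Δ T P) (hQ : LocallySolvable c n Δ R Q) :
    LocallySolvable c n Δ (2 * R + T + 1) fun d o =>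
      ∃ a o', P d a ∧ Q (d - 2 * (a / 2)) o' ∧ o = o' + a / 2 := by
  classical
  obtain ⟨F, hF, hF'⟩ := hP
  obtain ⟨G, hG, hG'⟩ := hQ
  -- `F` is known to orient only admissible instances, hence the dummy value elsewhere.
  refine ⟨fun N ident => if ho : N.IsOrientation (F N ident) then
    N.unhalve (F N ident) (G (N.halve _ ho) ident) else fun _ => false, ?_, ?_⟩
  · intro N N' ident ident' v v' ha ha' h i i' hi
    dsimp only
    rw [dif_pos (hF' N ident ha).1, dif_pos (hF' N' ident' ha').1]
    exact unhalve_of_viewEq hF hG ha ha' _ _ h hi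
  · intro N ident ha
    dsimp only
    obtain ⟨ho, h1⟩ := hF' N ident ha
    obtain ⟨ho', h2⟩ := hG' _ ident (ha.halve ho)
    rw [dif_pos ho]
    refine ⟨PortNetwork.isOrientation_unhalve ho', fun v => ⟨_, _, h1 v, ?_,
      PortNetwork.outdeg_unhalve ho' v⟩⟩
    have := h2 v
    rwa [show (N.halve _ ho).deg v = _ from
      freeDeg_eq (N.deg v) fun i => F N ident ⟨v, i⟩] at this

/-! ### Closed sets of half-edges near a cluster -/

/-- The cluster `y` can be reached from `x` within `j` steps, when `conn` is an involution on the
half-edges `H`, which are grouped into clusters by `κ`. -/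
def ReachIn {H K : Type*} (conn : H → H) (κ : H → K) (x : K) : ℕ → K → Prop
  | 0, y => y = x
  | j + 1, y => ReachIn conn κ x j y ∨ ∃ h, ReachIn conn κ x j (κ h) ∧ κ (conn h) = y

section closedSets

variable {H K : Type*} {conn : H → H} {κ : H → K} {x : K}

theorem ReachIn.mono {i j : ℕ} (hij : i ≤ j) {y : K} (h : ReachIn conn κ x i y) :
    ReachIn conn κ x j y := by
  induction j, hij using Nat.le_induction with
  | base => exact h
  | succ j _ ih => exact Or.inl ih

/-- The infimum is the distance from `x`, so this yields the parent pointers of a breadth-first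
tree: `h` lies at `y` and its other half is one step closer to the root. -/
theorem exists_parent_of_reachIn (hc : ∀ h, conn (conn h) = h) {r : ℕ} {y : K}
    (hy : ReachIn conn κ x r y) (hyx : y ≠ x) :
    ∃ h, κ h = y ∧ ReachIn conn κ x r (κ (conn h)) ∧
      sInf {j | ReachIn conn κ x j (κ (conn h))} + 1 = sInf {j | ReachIn conn κ x j y} := by
  have hne : {j | ReachIn conn κ x j y}.Nonempty := ⟨r, hy⟩
  have hmem : ReachIn conn κ x (sInf {j | ReachIn conn κ x j y}) y := Nat.sInf_mem hne
  have hle : sInf {j | ReachIn conn κ x j y} ≤ r := Nat.sInf_le hy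
  generalize hm : sInf {j | ReachIn conn κ x j y} = m at hmem hle
  cases m with
  | zero => exact absurd hmem hyx
  | succ m =>
    rcases hmem with h1 | ⟨h, h1, h2⟩
    · have : sInf {j | ReachIn conn κ x j y} ≤ m := Nat.sInf_le h1
      omega
    · refine ⟨conn h, h2, ?_, ?_⟩
      · rw [hc]
        exact h1.mono (by omega)
      · rw [hc]
        have h3 : sInf {j | ReachIn conn κ x j (κ h)} ≤ m := Nat.sInf_le h1
        have h4 : ReachIn conn κ x (sInf {j | ReachIn conn κ x j (κ h)}) (κ h) :=
          Nat.sInf_mem (s := {j | ReachIn conn κ x j (κ h)}) ⟨m, h1⟩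
        have h5 : sInf {j | ReachIn conn κ x j y} ≤ sInf {j | ReachIn conn κ x j (κ h)} + 1 :=
          Nat.sInf_le (Or.inr ⟨h, h4, h2⟩)
        omega

/-- The edges of a tree with root `x` can be directed towards any other node `a`. -/
theorem exists_rerooted (hc : ∀ h, conn (conn h) = h) (hne : ∀ h, conn h ≠ h) {B : K → Prop}
    {depth : K → ℕ} {p : K → H}
    (hp : ∀ y, B y → y ≠ x → κ (p y) = y ∧ B (κ (conn (p y))) ∧
      depth (κ (conn (p y))) + 1 = depth y) {a : K} (ha : B a) :
    ∃ g : K → H, (∀ u, B u → u ≠ a → κ (g u) = u ∧ B (κ (conn (g u))) ∧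
        ∃ w, B w ∧ w ≠ x ∧ (g u = p w ∨ g u = conn (p w))) ∧
      ∀ u u', B u → u ≠ a → B u' → u' ≠ a → g u ≠ conn (g u') := by
  classical
  induction hm : depth a using Nat.strong_induction_on generalizing a with
  | _ m ih =>
    by_cases hax : a = x
    · subst hax
      refine ⟨p, fun u hu hua => ⟨(hp u hu hua).1, (hp u hu hua).2.1, u, hu, hua, Or.inl rfl⟩, ?_⟩
      intro u u' hu hua hu' hua' h
      have h1 := (hp u hu hua).2.2
      have h2 := (hp u' hu' hua').2.2
      rw [← h, (hp u hu hua).1] at h2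
      rw [h, hc, (hp u' hu' hua').1] at h1
      omega
    · obtain ⟨h1, h2, h3⟩ := hp a ha hax
      obtain ⟨g, hg, hg'⟩ := ih _ (by omega) h2 rfl
      set b := κ (conn (p a)) with hb
      -- Starting from the tree directed towards the parent `b` of `a`, it suffices to reverse the
      -- edge between them: `b`, so far the sink, now points to `a`.
      refine ⟨Function.update g b (conn (p a)), fun u hu hua => ?_, ?_⟩
      · by_cases hub : u = b
        · subst hub
          rw [Function.update_self, hc, h1]
          exact ⟨rfl, ha, a, ha, hax, Or.inr rfl⟩
        · rw [Function.update_of_ne hub]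
          exact hg u hu hub
      · intro u u' hu hua hu' hua'
        by_cases hub : u = b
        · by_cases hub' : u' = b
          · rw [hub, hub']
            exact (hne _).symm
          · rw [hub, Function.update_self, Function.update_of_ne hub']
            intro h
            have h4 := congrArg conn h
            rw [hc, hc] at h4
            rw [h4, (hg u' hu' hub').1] at h1
            exact hua' h1
        · by_cases hub' : u' = b
          · rw [hub', Function.update_self, Function.update_of_ne hub, hc]
            intro h
            rw [← h, (hg u hu hub).1] at h1
            exact hua h1
          · rw [Function.update_of_ne hub, Function.update_of_ne hub']
            exact hg' u u' hu hub hu' hub'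

/-- If each node with the property `P` has three half-edges, then near each of them there is a set
of half-edges that orients its edges such that all nodes with the property `P` that it reaches have
an outgoing edge. -/
theorem exists_closed_set [Fintype H] [Fintype K] (hc : ∀ h, conn (conn h) = h)
    (hne : ∀ h, conn h ≠ h) {P : K → Prop}
    (hP : ∀ y, P y → ∃ f : Fin 3 → H, Function.Injective f ∧ ∀ k, κ (f k) = y) (hx : P x) {r : ℕ}
    (hr : Fintype.card K < 2 ^ r) :
    ∃ S : Finset H, (∀ h ∈ S, ReachIn conn κ x r (κ h)) ∧ (∀ h ∈ S, conn h ∉ S) ∧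
      (∀ h ∈ S, P (κ (conn h)) → ∃ h' ∈ S, κ h' = κ (conn h)) ∧ ∃ h ∈ S, κ h = x := by
  classical
  by_contra hS
  have : Nonempty H := ⟨(hP x hx).choose 0⟩
  set B : K → Prop := ReachIn conn κ x r with hB
  set depth : K → ℕ := fun y => sInf {j | ReachIn conn κ x j y} with hdepth
  have hBx : B x := ReachIn.mono (Nat.zero_le r) (i := 0) rfl
  have hpar : ∀ y, B y ∧ y ≠ x → ∃ h, κ h = y ∧ B (κ (conn h)) ∧
      depth (κ (conn h)) + 1 = depth y := fun y hy => exists_parent_of_reachIn hc hy.1 hy.2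
  choose! p hp using hpar
  replace hp := fun y h1 h2 => hp y ⟨h1, h2⟩
  -- A cluster `a` of the ball without `P` may be a sink, so the tree directed towards `a` would be
  -- a closed set.
  have hPB : ∀ a, B a → P a := by
    intro a ha
    by_contra hPa
    obtain ⟨g, hg, hg'⟩ := exists_rerooted hc hne hp ha
    have hxa : x ≠ a := fun h => hPa (h ▸ hx)
    refine hS ⟨(Finset.univ.filter fun u => B u ∧ u ≠ a).image g, ?_, ?_, ?_, ?_⟩
    · simp only [Finset.mem_image, Finset.mem_filter, Finset.mem_univ, true_and]
      rintro _ ⟨u, ⟨hu, hua⟩, rfl⟩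
      rw [(hg u hu hua).1]
      exact hu
    · simp only [Finset.mem_image, Finset.mem_filter, Finset.mem_univ, true_and]
      rintro _ ⟨u, ⟨hu, hua⟩, rfl⟩ ⟨u', ⟨hu', hua'⟩, h⟩
      exact hg' u' u hu' hua' hu hua h
    · simp only [Finset.mem_image, Finset.mem_filter, Finset.mem_univ, true_and]
      rintro _ ⟨u, ⟨hu, hua⟩, rfl⟩ hPu
      have h1 := (hg u hu hua).2.1
      have h2 : κ (conn (g u)) ≠ a := fun h => hPa (h ▸ hPu)
      exact ⟨_, ⟨_, ⟨h1, h2⟩, rfl⟩, (hg _ h1 h2).1⟩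
    · exact ⟨g x, Finset.mem_image_of_mem _ (Finset.mem_filter.2 ⟨Finset.mem_univ _, hBx, hxa⟩),
        (hg x hBx hxa).1⟩
  -- An edge `e` inside the ball but outside the tree would also give a closed set: direct the tree
  -- towards the cluster of `e` and let that cluster use `e` itself.
  have htree : ∀ e, B (κ e) → B (κ (conn e)) → ∃ w, B w ∧ w ≠ x ∧ (e = p w ∨ e = conn (p w)) := by
    intro e he hce
    by_contra hw
    obtain ⟨g, hg, hg'⟩ := exists_rerooted hc hne hp he
    have hf : ∀ u, B u → κ (Function.update g (κ e) e u) = u ∧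
        B (κ (conn (Function.update g (κ e) e u))) := by
      intro u hu
      by_cases hue : u = κ e
      · subst hue
        rw [Function.update_self]
        exact ⟨rfl, hce⟩
      · rw [Function.update_of_ne hue]
        exact ⟨(hg u hu hue).1, (hg u hu hue).2.1⟩
    refine hS ⟨(Finset.univ.filter B).image (Function.update g (κ e) e), ?_, ?_, ?_, ?_⟩
    · simp only [Finset.mem_image, Finset.mem_filter, Finset.mem_univ, true_and]
      rintro _ ⟨u, hu, rfl⟩
      rw [(hf u hu).1]
      exact hu
    · simp only [Finset.mem_image, Finset.mem_filter, Finset.mem_univ, true_and]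
      rintro _ ⟨u, hu, rfl⟩ ⟨u', hu', h⟩
      by_cases hue : u = κ e
      · by_cases hue' : u' = κ e
        · rw [hue, hue'] at h
          exact hne _ h.symm
        · rw [hue, Function.update_self, Function.update_of_ne hue'] at h
          obtain ⟨-, -, w, h1, h2, h3⟩ := hg u' hu' hue'
          rw [h] at h3
          exact hw ⟨w, h1, h2, h3.symm.imp (fun h => by rw [← hc e, h, hc])
            (fun h => by rw [← hc e, h])⟩
      · by_cases hue' : u' = κ e
        · rw [hue', Function.update_self, Function.update_of_ne hue] at h
          obtain ⟨-, -, w, h1, h2, h3⟩ := hg u hu hue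
          exact hw ⟨w, h1, h2, h3.symm.imp (fun h' => by rw [h, h', hc]) (fun h' => by rw [h, h'])⟩
        · rw [Function.update_of_ne hue, Function.update_of_ne hue'] at h
          exact hg' u' u hu' hue' hu hue h
    · simp only [Finset.mem_image, Finset.mem_filter, Finset.mem_univ, true_and]
      rintro _ ⟨u, hu, rfl⟩ -
      exact ⟨_, ⟨_, (hf u hu).2, rfl⟩, (hf _ (hf u hu).2).1⟩
    · exact ⟨_, Finset.mem_image_of_mem _ (Finset.mem_filter.2 ⟨Finset.mem_univ _, hBx⟩),
        (hf x hBx).1⟩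
  -- Otherwise the ball is a tree in which every cluster has three half-edges, so its layers double
  -- and layer `r` is larger than the number of clusters.
  have hgrow : ∀ j ≤ r, 2 ^ j ≤ (Finset.univ.filter fun y => B y ∧ depth y = j).card := by
    intro j
    induction j with
    | zero =>
      intro _
      rw [pow_zero, Nat.one_le_iff_ne_zero, ← Nat.pos_iff_ne_zero, Finset.card_pos]
      refine ⟨x, Finset.mem_filter.2 ⟨Finset.mem_univ _, hBx, ?_⟩⟩
      exact Nat.le_zero.1 (Nat.sInf_le (s := {j | ReachIn conn κ x j x}) rfl)
    | succ j ih =>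
      intro hj
      set L := Finset.univ.filter fun y => B y ∧ depth y = j with hL
      set X := Finset.univ.filter fun h => κ h ∈ L ∧ h ≠ p (κ h) with hX
      have h1 : L.card * 2 ≤ X.card := by
        rw [Finset.card_eq_sum_card_fiberwise (f := κ) (t := L)
          (fun h hh => (Finset.mem_filter.1 hh).2.1), ← smul_eq_mul]
        refine Finset.card_nsmul_le_sum _ _ _ fun y hy => ?_
        obtain ⟨f, hf, hfy⟩ := hP y (hPB y (Finset.mem_filter.1 hy).2.1)
        have h2 : ((Finset.univ.image f).erase (p y)).card ≥ 2 := by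
          have := Finset.pred_card_le_card_erase (s := Finset.univ.image f) (a := p y)
          rw [Finset.card_image_of_injective _ hf, Finset.card_univ, Fintype.card_fin] at this
          exact this
        refine h2.le.trans (Finset.card_le_card fun h hh => ?_)
        obtain ⟨hh1, hh2⟩ := Finset.mem_erase.1 hh
        obtain ⟨k, -, rfl⟩ := Finset.mem_image.1 hh2
        simp only [hX, Finset.mem_filter, Finset.mem_univ, true_and, hfy]
        exact ⟨⟨hy, hh1⟩, trivial⟩
      -- Each non-parent half-edge in layer `j` is opposite to the parent half-edge of the cluster
      -- it leads to. So distinct ones lead to distinct clusters, one layer further out.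
      have h2 : ∀ h ∈ X, B (κ (conn h)) ∧ κ (conn h) ≠ x ∧ h = conn (p (κ (conn h))) := by
        intro h hh
        obtain ⟨-, hhL, hhp⟩ := Finset.mem_filter.1 hh
        obtain ⟨-, hhB, hhd⟩ := Finset.mem_filter.1 hhL
        have hreach : ReachIn conn κ x j (κ h) := by
          rw [← hhd]
          exact Nat.sInf_mem (s := {j | ReachIn conn κ x j (κ h)}) ⟨r, hhB⟩
        have hB' : B (κ (conn h)) :=
          ReachIn.mono hj (i := j + 1) (Or.inr ⟨h, hreach, rfl⟩)
        obtain ⟨w, hw1, hw2, h3 | h3⟩ := htree h hhB hB'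
        · refine absurd ?_ hhp
          rw [h3, (hp w hw1 hw2).1]
        · have h4 : κ (conn h) = w := by
            rw [h3, hc, (hp w hw1 hw2).1]
          rw [h4]
          exact ⟨hw1, hw2, h3⟩
      have h3 : X.card ≤ (Finset.univ.filter fun y => B y ∧ depth y = j + 1).card := by
        refine Finset.card_le_card_of_injOn (fun h => κ (conn h)) ?_ ?_
        · intro h hh
          obtain ⟨h4, h5, h6⟩ := h2 h hh
          have h7 := (hp _ h4 h5).2.2
          rw [← h6, (Finset.mem_filter.1 (Finset.mem_filter.1 hh).2.1).2.2] at h7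
          exact Finset.mem_coe.2 (Finset.mem_filter.2 ⟨Finset.mem_univ _, h4, h7.symm⟩)
        · intro h hh h' hh' heq
          rw [(h2 h hh).2.2, (h2 h' hh').2.2]
          exact congrArg (fun y => conn (p y)) heq
      have h4 := ih (by omega)
      rw [pow_succ]
      omega
  have h1 := hgrow r le_rfl
  have h2 := Finset.card_le_univ (Finset.univ.filter fun y => B y ∧ depth y = r)
  omega

end closedSets

/-! ### Neighbourhoods and their transfer between networks -/

/-- The node `w` can be reached from `v` within the given number of steps. -/
def Near {V : Type} (N : PortNetwork V) : ℕ → V → V → Prop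
  | 0, v, w => w = v
  | t + 1, v, w => w = v ∨ ∃ i, Near N t (N.conn ⟨v, i⟩).1 w

namespace Near

variable {V : Type} {N N' : PortNetwork V} {ident ident' : V → ℕ}

theorem refl (t : ℕ) (v : V) : Near N t v v := by
  cases t with
  | zero => rfl
  | succ t => exact Or.inl rfl

theorem succ {t : ℕ} {v w : V} (h : Near N t v w) : Near N (t + 1) v w := by
  induction t generalizing v with
  | zero => exact Or.inl h
  | succ t ih => exact h.imp id fun ⟨i, hi⟩ => ⟨i, ih hi⟩

theorem conn {t : ℕ} {v : V} {h : N.HalfEdge} (hn : Near N t v h.1) :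
    Near N (t + 1) v (N.conn h).1 := by
  induction t generalizing v with
  | zero =>
    obtain ⟨w, i⟩ := h
    obtain rfl : w = v := hn
    exact Or.inr ⟨i, rfl⟩
  | succ t ih =>
    rcases hn with h1 | ⟨i, hi⟩
    · obtain ⟨w, i⟩ := h
      obtain rfl : w = v := h1
      exact Or.inr ⟨i, refl _ _⟩
    · exact Or.inr ⟨i, ih hi⟩

theorem symm {t : ℕ} {v w : V} (h : Near N t v w) : Near N t w v := by
  induction t generalizing v with
  | zero => exact Eq.symm h
  | succ t ih =>
    rcases h with h | ⟨i, hi⟩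
    · exact Or.inl h.symm
    · have := (ih hi).conn
      rwa [N.conn_conn] at this

theorem transfer {s t : ℕ} {v v' w : V} (h : ViewEq N N' ident ident' (s + t) v v')
    (hw : Near N t v w) : ∃ w', Near N' t v' w' ∧ ViewEq N N' ident ident' s w w' := by
  induction t generalizing v v' with
  | zero =>
    obtain rfl : w = v := hw
    exact ⟨v', rfl, h⟩
  | succ t ih =>
    rcases hw with rfl | ⟨i, hi⟩
    · exact ⟨v', refl _ _, h.mono (by omega)⟩
    · obtain ⟨i', hi'⟩ := Fin.exists_val_eq h.deg_eq i
      obtain ⟨w', h1, h2⟩ := ih (h.2 i i' hi').2 hi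
      exact ⟨w', Or.inr ⟨i', h1⟩, h2⟩

end Near

/-! ### Logarithmic-time orientation for degrees up to nine -/

/-- The ports of a node are grouped into three triples and a rest. -/
def portTriple (j : ℕ) : Fin 4 := ⟨min (j / 3) 3, by omega⟩

/-- The groups of ports that are required to contain an outgoing port. -/
def IsFullTriple (d : ℕ) (q : Fin 4) : Prop := d ≤ 9 ∧ 3 * q.val + 3 ≤ d

namespace PortNetwork

variable {V : Type} (N : PortNetwork V) (ident : V → ℕ)

/-- The name of a half-edge. -/
def code (h : N.HalfEdge) : ℕ × ℕ := (ident h.1, h.2.val)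

variable {N ident}

theorem code_injective (hi : Function.Injective ident) : Function.Injective (N.code ident) := by
  rintro ⟨v, i⟩ ⟨w, j⟩ h
  simp only [code, Prod.mk.injEq] at h
  obtain rfl := hi h.1
  rw [Fin.ext h.2]

theorem code_conn_eq_of_viewEq {N' : PortNetwork V} {ident' : V → ℕ} {t : ℕ} {v v' : V}
    (h : ViewEq N N' ident ident' (t + 1) v v') {i : Fin (N.deg v)} {i' : Fin (N'.deg v')}
    (hi : i.val = i'.val) :
    N.code ident (N.conn ⟨v, i⟩) = N'.code ident' (N'.conn ⟨v', i'⟩) :=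
  Prod.ext (h.2 i i' hi).2.ident_eq (h.2 i i' hi).1

variable (N ident)

/-- A set of names of half-edges near `u` that orients its edges such that each full triple that it
reaches has an outgoing port. -/
structure IsClosedNear (r : ℕ) (u : V) (S : Finset (ℕ × ℕ)) : Prop where
  near : ∀ x ∈ S, ∃ h : N.HalfEdge, Near N r u h.1 ∧ N.code ident h = x
  conn_notMem : ∀ h : N.HalfEdge, Near N r u h.1 → N.code ident h ∈ S →
    N.code ident (N.conn h) ∉ S
  closed : ∀ h : N.HalfEdge, Near N r u h.1 → N.code ident h ∈ S →
    IsFullTriple (N.deg (N.conn h).1) (portTriple (N.conn h).2) →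
      ∃ i : Fin (N.deg (N.conn h).1), portTriple i = portTriple (N.conn h).2 ∧
        N.code ident ⟨(N.conn h).1, i⟩ ∈ S

/-- The closed sets that contain the edge of the half-edge `h`. -/
def closedSets (r : ℕ) (h : N.HalfEdge) : Set (Finset (ℕ × ℕ)) :=
  {S | (∃ u, N.IsClosedNear ident r u S) ∧ (N.code ident h ∈ S ∨ N.code ident (N.conn h) ∈ S)}

variable {N ident}

theorem closedSets_conn (r : ℕ) (h : N.HalfEdge) :
    N.closedSets ident r (N.conn h) = N.closedSets ident r h := by
  simp only [closedSets, N.conn_conn, or_comm]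

theorem IsClosedNear.near_of_mem (hi : Function.Injective ident) {r : ℕ} {u : V}
    {S : Finset (ℕ × ℕ)} (hS : N.IsClosedNear ident r u S) {h : N.HalfEdge}
    (hh : N.code ident h ∈ S) : Near N r u h.1 := by
  obtain ⟨h', h1, h2⟩ := hS.near _ hh
  rwa [← code_injective hi h2]

/-- All conditions concern half-edges within distance `r` and the nodes across their edges, hence
the radius `r + 1`. Sets of names, unlike sets of half-edges, make sense in both networks. -/
theorem IsClosedNear.of_viewEq {N' : PortNetwork V} {ident' : V → ℕ} {r : ℕ} {u u' : V}
    (h : ViewEq N N' ident ident' (r + 1) u u') {S : Finset (ℕ × ℕ)}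
    (hS : N.IsClosedNear ident r u S) : N'.IsClosedNear ident' r u' S := by
  rw [add_comm] at h
  have back : ∀ h' : N'.HalfEdge, Near N' r u' h'.1 → ∃ (w : V) (i : Fin (N.deg w)),
      Near N r u w ∧ ViewEq N N' ident ident' 1 w h'.1 ∧ i.val = h'.2.val := by
    rintro ⟨w', i'⟩ hw'
    obtain ⟨w, h1, h2⟩ := Near.transfer h.symm hw'
    obtain ⟨i, hi⟩ := Fin.exists_val_eq h2.deg_eq i'
    exact ⟨w, i, h1, h2.symm, hi.symm⟩
  refine ⟨fun x hx => ?_, fun h' hn hm => ?_, fun h' hn hm => ?_⟩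
  · obtain ⟨⟨w, i⟩, h1, rfl⟩ := hS.near x hx
    obtain ⟨w', h2, h3⟩ := Near.transfer h h1
    obtain ⟨i', hi⟩ := Fin.exists_val_eq h3.deg_eq i
    exact ⟨⟨w', i'⟩, h2, Prod.ext h3.ident_eq.symm hi.symm⟩
  · obtain ⟨w, i, h1, h2, h3⟩ := back h' hn
    have hcode : N.code ident ⟨w, i⟩ = N'.code ident' h' := Prod.ext h2.ident_eq h3
    rw [← code_conn_eq_of_viewEq h2 h3]
    exact hS.conn_notMem ⟨w, i⟩ h1 (hcode ▸ hm)
  · obtain ⟨w, i, h1, h2, h3⟩ := back h' hn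
    have hcode : N.code ident ⟨w, i⟩ = N'.code ident' h' := Prod.ext h2.ident_eq h3
    obtain ⟨h4, h5⟩ := h2.2 i h'.2 h3
    change (N.conn ⟨w, i⟩).2.val = (N'.conn h').2.val at h4
    change ViewEq N N' ident ident' 0 _ (N'.conn h').1 at h5
    intro hfull
    rw [← h4, ← h5.deg_eq] at hfull
    obtain ⟨j, hj1, hj2⟩ := hS.closed ⟨w, i⟩ h1 (hcode ▸ hm) hfull
    obtain ⟨j', hj'⟩ := Fin.exists_val_eq h5.deg_eq j
    refine ⟨j', by rw [← hj', ← h4, hj1], ?_⟩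
    rwa [show N'.code ident' ⟨(N'.conn h').1, j'⟩ = N.code ident ⟨(N.conn ⟨w, i⟩).1, j⟩ from
      Prod.ext h5.ident_eq.symm hj'.symm]

/-- A closed set containing an edge at `v` has its centre within distance `r + 1`, and a view of
radius `r + 1` around the centre certifies it; the two radii add up to `2 * r + 2`. -/
theorem closedSets_subset_of_viewEq {N' : PortNetwork V} {ident' : V → ℕ}
    (hi : Function.Injective ident) {r : ℕ} {v v' : V}
    (h : ViewEq N N' ident ident' (2 * r + 2) v v') {i : Fin (N.deg v)} {i' : Fin (N'.deg v')}
    (hii : i.val = i'.val) :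
    N.closedSets ident r ⟨v, i⟩ ⊆ N'.closedSets ident' r ⟨v', i'⟩ := by
  rintro S ⟨⟨u, hu⟩, hS⟩
  have hnear : Near N (r + 1) v u := by
    rcases hS with hS | hS
    · exact (hu.near_of_mem hi hS).symm.succ
    · have := (hu.near_of_mem hi hS).conn
      rw [N.conn_conn] at this
      exact this.symm
  obtain ⟨u', -, h1⟩ := Near.transfer (s := r + 1) (h.mono (by omega)) hnear
  refine ⟨⟨u', hu.of_viewEq h1⟩, ?_⟩
  rwa [← code_conn_eq_of_viewEq h hii,
    show N'.code ident' ⟨v', i'⟩ = N.code ident ⟨v, i⟩ from Prod.ext h.ident_eq.symm hii.symm]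

/-- The clusters are the pairs of a node and a group of ports, `4 * n` in total; full triples are
the clusters that supply three half-edges. -/
theorem exists_isClosedNear {n : ℕ} {N : PortNetwork (Fin n)} {ident : Fin n → ℕ}
    (hi : Function.Injective ident) {r : ℕ} (hr : 4 * n < 2 ^ r) {v : Fin n} {q : Fin 4}
    (hq : IsFullTriple (N.deg v) q) :
    ∃ S, N.IsClosedNear ident r v S ∧
      ∃ i : Fin (N.deg v), portTriple i = q ∧ N.code ident ⟨v, i⟩ ∈ S := by
  classical
  obtain ⟨S, h1, h2, h3, ⟨w, i⟩, h4, h5⟩ := exists_closed_set (conn := N.conn)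
    (κ := fun h => (h.1, portTriple h.2)) (x := (v, q))
    (P := fun y => IsFullTriple (N.deg y.1) y.2) N.conn_conn N.conn_ne
    (by
      rintro ⟨w, s⟩ ⟨-, hs⟩
      refine ⟨fun k => ⟨w, ⟨3 * s.val + k.val, by dsimp only at hs; omega⟩⟩, ?_, ?_⟩
      · intro k l hkl
        simp only [Sigma.mk.injEq, heq_eq_eq, true_and, Fin.mk.injEq] at hkl
        omega
      · intro k
        refine Prod.ext rfl (Fin.ext ?_)
        simp only [portTriple]
        omega)
    hq (r := r) (by simp only [Fintype.card_prod, Fintype.card_fin]; omega)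
  have hreach : ∀ (j : ℕ) (y : Fin n × Fin 4),
      ReachIn N.conn (fun h => (h.1, portTriple h.2)) (v, q) j y → Near N j v y.1 := by
    intro j
    induction j with
    | zero =>
      rintro _ rfl
      rfl
    | succ j ih =>
      rintro _ (h | ⟨h, h, rfl⟩)
      · exact (ih _ h).succ
      · exact (ih _ h).conn
  have hmem : ∀ h, N.code ident h ∈ S.image (N.code ident) ↔ h ∈ S := fun h => by
    rw [Finset.mem_image]
    exact ⟨fun ⟨h', h6, h7⟩ => code_injective hi h7 ▸ h6, fun h' => ⟨h, h', rfl⟩⟩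
  refine ⟨S.image (N.code ident), ⟨fun x hx => ?_, fun h _ hh => ?_, fun h _ hh hf => ?_⟩, ?_⟩
  · obtain ⟨h, hh, rfl⟩ := Finset.mem_image.1 hx
    exact ⟨h, hreach _ _ (h1 h hh), rfl⟩
  · rw [hmem] at hh ⊢
    exact h2 h hh
  · rw [hmem] at hh
    obtain ⟨⟨w', i'⟩, h6, h7⟩ := h3 h hh hf
    obtain ⟨h8, h9⟩ := Prod.ext_iff.1 h7
    dsimp only at h8 h9
    subst h8
    exact ⟨i', h9, (hmem _).2 h6⟩
  · obtain ⟨h8, h9⟩ := Prod.ext_iff.1 h5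
    dsimp only at h8 h9
    subst h8
    exact ⟨i, h9, (hmem _).2 h4⟩

end PortNetwork

open Classical in
/-- The element of a set of finite sets that comes first in a fixed enumeration. -/
noncomputable def firstSet (K : Set (Finset (ℕ × ℕ))) : Finset (ℕ × ℕ) :=
  if hK : K.Nonempty then Function.argminOn Encodable.encode K hK else ∅

theorem firstSet_mem {K : Set (Finset (ℕ × ℕ))} (hK : K.Nonempty) : firstSet K ∈ K := by
  rw [firstSet, dif_pos hK]
  exact Function.argminOn_mem _ _ _

theorem encode_firstSet_le {K : Set (Finset (ℕ × ℕ))} {S : Finset (ℕ × ℕ)} (hS : S ∈ K) :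
    Encodable.encode (firstSet K) ≤ Encodable.encode S := by
  rw [firstSet, dif_pos ⟨S, hS⟩]
  exact Function.argminOn_le _ _ hS

open Classical in
/-- Each edge is oriented by the first closed set that contains it, or else by the names of its
halves. -/
noncomputable def closedSetRule (n r : ℕ) : OrientationRule n := fun N ident h =>
  if (N.closedSets ident r h).Nonempty then
    decide (N.code ident h ∈ firstSet (N.closedSets ident r h))
  else decide (toLex (N.code ident h) < toLex (N.code ident (N.conn h)))

section closedSetRule

variable {n r : ℕ} {N : PortNetwork (Fin n)} {ident : Fin n → ℕ}

theorem closedSetRule_of_nonempty {h : N.HalfEdge} (hne : (N.closedSets ident r h).Nonempty) :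
    closedSetRule n r N ident h = true ↔
      N.code ident h ∈ firstSet (N.closedSets ident r h) := by
  rw [closedSetRule, if_pos hne, decide_eq_true_eq]

theorem closedSetRule_of_not_nonempty {h : N.HalfEdge}
    (hne : ¬(N.closedSets ident r h).Nonempty) :
    closedSetRule n r N ident h = true ↔
      toLex (N.code ident h) < toLex (N.code ident (N.conn h)) := by
  rw [closedSetRule, if_neg hne, decide_eq_true_eq]

theorem closedSetRule_isLocal (c Δ : ℕ) :
    (closedSetRule n r).IsLocal c Δ (2 * r + 2) := by
  intro N N' ident ident' v v' ha ha' h i i' hi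
  have h1 : N.closedSets ident r ⟨v, i⟩ = N'.closedSets ident' r ⟨v', i'⟩ :=
    (PortNetwork.closedSets_subset_of_viewEq ha.injective h hi).antisymm
      (PortNetwork.closedSets_subset_of_viewEq ha'.injective h.symm hi.symm)
  have h2 : N.code ident ⟨v, i⟩ = N'.code ident' ⟨v', i'⟩ := Prod.ext h.ident_eq hi
  rw [Bool.eq_iff_iff]
  by_cases hne : (N.closedSets ident r ⟨v, i⟩).Nonempty
  · rw [closedSetRule_of_nonempty hne, closedSetRule_of_nonempty (h1 ▸ hne), h1, h2]
  · rw [closedSetRule_of_not_nonempty hne, closedSetRule_of_not_nonempty (h1 ▸ hne), h2,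
      PortNetwork.code_conn_eq_of_viewEq h hi]

theorem isOrientation_closedSetRule (hi : Function.Injective ident) :
    N.IsOrientation (closedSetRule n r N ident) := by
  intro h
  have hconn := PortNetwork.closedSets_conn (N := N) (ident := ident) r h
  rw [Bool.eq_iff_iff, Bool.not_eq_true', ← Bool.not_eq_true]
  by_cases hne : (N.closedSets ident r h).Nonempty
  · rw [closedSetRule_of_nonempty hne, closedSetRule_of_nonempty (hconn.symm ▸ hne), hconn]
    obtain ⟨⟨u, hu⟩, hS⟩ := firstSet_mem hne
    exact ⟨fun h1 h2 => hu.conn_notMem h (hu.near_of_mem hi h2) h2 h1, hS.resolve_left⟩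
  · rw [closedSetRule_of_not_nonempty hne, closedSetRule_of_not_nonempty (hconn.symm ▸ hne),
      N.conn_conn, not_lt, le_iff_lt_or_eq, or_iff_left]
    exact fun h1 => N.conn_ne h (PortNetwork.code_injective hi (toLex.injective h1))

/-- Consider the first closed set that leaves the triple, say through port `i`. Any closed set
containing the edge at `i` either leaves the triple there or enters it, and then leaves it elsewhere
by closedness. So no earlier set contains this edge, and the edge obeys the set considered. -/
theorem exists_out_of_isFullTriple (hi : Function.Injective ident) (hr : 4 * n < 2 ^ r) {v : Fin n}
    {q : Fin 4} (hq : IsFullTriple (N.deg v) q) :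
    ∃ i : Fin (N.deg v), portTriple i = q ∧ closedSetRule n r N ident ⟨v, i⟩ = true := by
  set X : Set (Finset (ℕ × ℕ)) := {S | (∃ u, N.IsClosedNear ident r u S) ∧
    ∃ i : Fin (N.deg v), portTriple i = q ∧ N.code ident ⟨v, i⟩ ∈ S} with hX
  have hne : X.Nonempty := by
    obtain ⟨S, h1, h2⟩ := PortNetwork.exists_isClosedNear hi hr hq
    exact ⟨S, ⟨v, h1⟩, h2⟩
  obtain ⟨⟨u, hu⟩, i, hiq, hiS⟩ := firstSet_mem hne
  have h1 : firstSet X ∈ N.closedSets ident r ⟨v, i⟩ := ⟨⟨u, hu⟩, Or.inl hiS⟩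
  have h2 : firstSet (N.closedSets ident r ⟨v, i⟩) ∈ X := by
    obtain ⟨⟨w, hw⟩, hS⟩ := firstSet_mem ⟨_, h1⟩
    refine ⟨⟨w, hw⟩, ?_⟩
    rcases hS with hS | hS
    · exact ⟨i, hiq, hS⟩
    · have h3 := hw.closed _ (hw.near_of_mem hi hS) hS
      rw [N.conn_conn] at h3
      simp only [hiq] at h3
      exact h3 hq
  have h3 : firstSet (N.closedSets ident r ⟨v, i⟩) = firstSet X :=
    Encodable.encode_injective (le_antisymm (encode_firstSet_le h1) (encode_firstSet_le h2))
  refine ⟨i, hiq, ?_⟩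
  rw [closedSetRule_of_nonempty ⟨_, h1⟩, h3]
  exact hiS

theorem div_three_le_outdeg_closedSetRule (hi : Function.Injective ident) (hr : 4 * n < 2 ^ r)
    {v : Fin n} (hv : N.deg v ≤ 9) : N.deg v / 3 ≤ N.outdeg (closedSetRule n r N ident) v := by
  have h : ∀ q : Fin (N.deg v / 3), ∃ i : Fin (N.deg v), i.val / 3 = q.val ∧
      closedSetRule n r N ident ⟨v, i⟩ = true := by
    intro q
    obtain ⟨i, h1, h2⟩ := exists_out_of_isFullTriple (q := ⟨q.val, by omega⟩) hi hr
      (show IsFullTriple (N.deg v) _ from ⟨hv, by dsimp only; omega⟩)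
    have h3 := congrArg Fin.val h1
    simp only [portTriple] at h3
    exact ⟨i, by omega, h2⟩
  choose f hf hf' using h
  rw [← Fintype.card_fin (N.deg v / 3), ← Finset.card_univ]
  refine Finset.card_le_card_of_injOn f
    (fun q _ => Finset.mem_coe.2 (Finset.mem_filter.2 ⟨Finset.mem_univ _, hf' q⟩)) ?_
  intro q _ q' _ hqq
  exact Fin.ext (by rw [← hf q, ← hf q', hqq])

end closedSetRule

/-- Weak `⌊d(v)/3⌋`-orientations for the nodes of degree at most nine. -/
theorem locallySolvable_div_three (c n Δ : ℕ) {r : ℕ} (hr : 4 * n < 2 ^ r) :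
    LocallySolvable c n Δ (2 * r + 2) fun d o => d ≤ 9 → d / 3 ≤ o :=
  ⟨closedSetRule n r, closedSetRule_isLocal c Δ, fun _ _ ha =>
    ⟨isOrientation_closedSetRule ha.injective, fun _ hv =>
      div_three_le_outdeg_closedSetRule ha.injective hr hv⟩⟩

/-! ### The number of contractions and its cost -/

/-- With `θ = 1/2 + ε₁`, let `i` be the real solution of `θ ^ x = ε₂ / 5` rounded up. Rounding costs
a factor 2; the 5 costs at most `5 ^ 2`, because `θ ≤ 2/3` gives `2 * θ ^ 2 < 1`. Together this is
50. -/
theorem exists_pow_le_and_two_pow_le {ε₁ ε₂ : ℝ} (h2 : 0 < ε₂) (h21 : ε₂ < ε₁) (h1 : ε₁ ≤ 1 / 6) :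
    ∃ i : ℕ, 5 * (1 / 2 + ε₁) ^ i ≤ ε₂ ∧
      (2 : ℝ) ^ i ≤ 50 * ε₂ ^ (1 / Real.logb 2 (1 / 2 + ε₁)) := by
  set θ : ℝ := 1 / 2 + ε₁ with hθ
  have hθ0 : 0 < θ := by linarith
  have hθ1 : θ < 1 := by linarith
  have hlog2 : 0 < Real.log 2 := Real.log_pos (by norm_num)
  have hlogθ : Real.log θ < 0 := Real.log_neg hθ0 hθ1
  have he : 1 / Real.logb 2 θ = Real.log 2 / Real.log θ := by
    rw [Real.logb, one_div_div]
  set x : ℝ := Real.log (ε₂ / 5) / Real.log θ with hx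
  have hx0 : 0 ≤ x :=
    div_nonneg_of_nonpos (Real.log_nonpos (by positivity) (by linarith)) hlogθ.le
  have hθx : θ ^ x = ε₂ / 5 := by
    rw [Real.rpow_def_of_pos hθ0, hx, mul_div_cancel₀ _ hlogθ.ne, Real.exp_log (by positivity)]
  have h2x : (2 : ℝ) ^ x = (ε₂ / 5) ^ (1 / Real.logb 2 θ) := by
    rw [he, Real.rpow_def_of_pos (by norm_num : (0 : ℝ) < 2),
      Real.rpow_def_of_pos (by positivity : 0 < ε₂ / 5), hx]
    congr 1
    ring
  refine ⟨⌈x⌉₊, ?_, ?_⟩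
  · have : θ ^ ⌈x⌉₊ ≤ θ ^ x := by
      rw [← Real.rpow_natCast]
      exact Real.rpow_le_rpow_of_exponent_ge hθ0 hθ1.le (Nat.le_ceil x)
    linarith
  · have hc : (2 : ℝ) ^ ⌈x⌉₊ ≤ 2 ^ (x + 1) := by
      rw [← Real.rpow_natCast]
      exact Real.rpow_le_rpow_of_exponent_le (by norm_num) (Nat.ceil_lt_add_one hx0).le
    have h5 : ((5 : ℝ) ^ (1 / Real.logb 2 θ))⁻¹ ≤ 25 := by
      rw [← Real.rpow_neg (by norm_num), show (25 : ℝ) = 5 ^ (2 : ℝ) by norm_num, he]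
      refine Real.rpow_le_rpow_of_exponent_le (by norm_num) ?_
      rw [← div_neg, div_le_iff₀ (by linarith)]
      have h3 : Real.log θ ≤ Real.log (2 / 3) := Real.log_le_log hθ0 (by linarith)
      have h4 : Real.log 2 + 2 * Real.log (2 / 3) ≤ 0 := by
        have : Real.log 2 + 2 * Real.log (2 / 3) = Real.log (2 * (2 / 3) ^ 2) := by
          rw [Real.log_mul (by norm_num) (by norm_num), Real.log_pow]
          norm_num
        rw [this]
        exact Real.log_nonpos (by norm_num) (by norm_num)
      linarith
    rw [Real.rpow_add (by norm_num), Real.rpow_one, h2x, Real.div_rpow h2.le (by norm_num),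
      div_eq_mul_inv] at hc
    have := mul_le_mul_of_nonneg_left h5 (Real.rpow_nonneg h2.le (1 / Real.logb 2 θ))
    linarith

/-- As `ε₂ < 1`, it suffices to compare exponents, for which `log (1 + 2 * ε₁) ≤ 2 * ε₁` and `ε₁ ≤
1/6` are enough. -/
theorem rpow_inv_logb_le {ε₁ ε₂ : ℝ} (h2 : 0 < ε₂) (h21 : ε₂ < ε₁) (h1 : ε₁ ≤ 1 / 6) :
    ε₂ ^ (1 / Real.logb 2 (1 / 2 + ε₁)) ≤ ε₂ ^ (-(1 + 24 * ε₁)) := by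
  refine Real.rpow_le_rpow_of_exponent_ge h2 (by linarith) ?_
  have hlog2 : 0.69 < Real.log 2 := by linarith [Real.log_two_gt_d9]
  have hlogθ : Real.log (1 / 2 + ε₁) < 0 := Real.log_neg (by linarith) (by linarith)
  have hle : Real.log (1 / 2 + ε₁) ≤ 2 * ε₁ - Real.log 2 := by
    rw [show 1 / 2 + ε₁ = (1 + 2 * ε₁) / 2 by ring, Real.log_div (by linarith) (by norm_num)]
    linarith [Real.log_le_sub_one_of_pos (show 0 < 1 + 2 * ε₁ by linarith)]
  rw [Real.logb, one_div_div, le_div_iff_of_neg hlogθ]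
  nlinarith [mul_le_mul_of_nonneg_left hle (show 0 ≤ 1 + 24 * ε₁ by linarith),
    mul_pos (h2.trans h21) (sub_pos.2 hlog2), mul_nonneg (h2.trans h21).le (sub_nonneg.2 h1)]

/-! ### Iterated contraction -/

/-- A contraction replaces the radius `R` by `2 * R + T + 1`, so `R + T + 1` doubles exactly. Of the
`d - d'` ports that get paired, half become outgoing, whence the bound on the final outdegree. -/
theorem exists_iterate_halve {c n Δ T R₀ : ℕ} {ε : ℝ} (h0 : 0 < ε) (h1 : ε ≤ 1 / 6)
    (hA : LocallySolvable c n Δ T fun d o => (1 / 2 - ε) * (d : ℝ) - 2 ≤ (o : ℝ))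
    {P : ℕ → ℕ → Prop} (hB : LocallySolvable c n Δ R₀ P) (i : ℕ) :
    ∃ R : ℕ, R + T + 1 = 2 ^ i * (R₀ + T + 1) ∧ LocallySolvable c n Δ R fun d o =>
      ∃ d' o' : ℕ, (d' : ℝ) - 9 ≤ (1 / 2 + ε) ^ i * ((d : ℝ) - 9) ∧ P d' o' ∧
        (d : ℝ) / 2 - d' / 2 + o' ≤ o := by
  induction i with
  | zero =>
    exact ⟨R₀, by ring, hB.imp fun d o h => ⟨d, o, by simp, h, by simp⟩⟩
  | succ i ih =>
    obtain ⟨R, hR, hi⟩ := ih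
    refine ⟨2 * R + T + 1, by rw [pow_succ, mul_assoc, mul_left_comm, ← hR]; ring,
      (hA.halve hi).imp ?_⟩
    rintro d o ⟨a, o', ha, ⟨d₂, o₂, h2, h3, h4⟩, rfl⟩
    have ha' : (a : ℝ) ≤ 2 * (a / 2 : ℕ) + 1 := by
      exact_mod_cast (show a ≤ 2 * (a / 2) + 1 by omega)
    set b := a / 2 with hb
    have hd : (d : ℝ) ≤ (d - 2 * b : ℕ) + 2 * b := by
      exact_mod_cast (show d ≤ d - 2 * b + 2 * b by omega)
    -- One contraction leaves at most `(1/2 + ε) * d + 3` ports: 2 from the slack of the orientation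
    -- and 1 from an unpaired outgoing port. The fixed point of this map is `3 / (1/2 - ε) ≤ 9`,
    -- which is where `ε ≤ 1/6` is needed.
    have hd' : ((d - 2 * b : ℕ) : ℝ) - 9 ≤ (1 / 2 + ε) * ((d : ℝ) - 9) := by
      rcases Nat.le_total (2 * b) d with hbd | hbd
      · rw [Nat.cast_sub hbd]
        push_cast
        nlinarith
      · rw [Nat.sub_eq_zero_of_le hbd]
        push_cast
        nlinarith [mul_nonneg (show 0 ≤ 1 / 2 + ε by linarith) (Nat.cast_nonneg (α := ℝ) d)]
    refine ⟨d₂, o₂, h2.trans ?_, h3, ?_⟩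
    · rw [pow_succ, mul_assoc]
      exact mul_le_mul_of_nonneg_left hd' (by positivity)
    · push_cast
      linarith

theorem le_outdeg_of_iterate_halve {ε₁ ε₂ : ℝ} (h0 : 0 < ε₂) (h1 : 0 < ε₁) {i : ℕ}
    (hi : 5 * (1 / 2 + ε₁) ^ i ≤ ε₂) {d o d' o' : ℕ}
    (hd : (d' : ℝ) - 9 ≤ (1 / 2 + ε₁) ^ i * ((d : ℝ) - 9)) (ho' : d' ≤ 9 → d' / 3 ≤ o')
    (ho : (d : ℝ) / 2 - d' / 2 + o' ≤ o) : (1 / 2 - ε₂) * (d : ℝ) - 2 ≤ o := by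
  have hd0 : (0 : ℝ) ≤ d := Nat.cast_nonneg d
  rcases Nat.lt_or_ge 9 d' with h | h
  -- For `d' ≥ 10` one has `d' / 2 ≤ 5 * (d' - 9)`, so the loss is at most `5 * (1/2 + ε₁) ^ i * d`;
  -- this explains the factor 5.
  · have h2 : (10 : ℝ) ≤ d' := by exact_mod_cast h
    have h3 : (0 : ℝ) ≤ o' := Nat.cast_nonneg o'
    have h4 := mul_le_mul_of_nonneg_right hi hd0
    have h5 : 0 ≤ (1 / 2 + ε₁) ^ i := by positivity
    linarith
  · have h2 := ho' h
    -- Thirds suffice because `d' / 2 - ⌊d' / 3⌋ ≤ 2` up to 9, with equality at 8.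
    have h3 : (d' : ℝ) ≤ 2 * (o' + 2) := by exact_mod_cast (show d' ≤ 2 * (o' + 2) by omega)
    have h4 := mul_nonneg h0.le hd0
    linarith

/-! ### The case of zero rounds -/

namespace PortNetwork

/-- The network in which the half-edges are connected as their preimages under `σ` are in `N`. -/
def permute {V : Type} (N : PortNetwork V) (σ : Equiv.Perm N.HalfEdge) : PortNetwork V where
  deg := N.deg
  conn h := σ (N.conn (σ.symm h))
  conn_conn h := by simp [N.conn_conn]
  conn_ne h hh := N.conn_ne (σ.symm h) (by rw [Equiv.eq_symm_apply]; exact hh)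

end PortNetwork

/-- Without communication, only networks with a single edge can be oriented. -/
theorem deg_lt_three_of_isLocal_zero {c n Δ : ℕ} {F : OrientationRule n} (hF : F.IsLocal c Δ 0)
    (ho : ∀ N ident, Admissible c Δ N ident → N.IsOrientation (F N ident))
    {N : PortNetwork (Fin n)} {ident : Fin n → ℕ} (ha : Admissible c Δ N ident) (v : Fin n) :
    N.deg v < 3 := by
  classical
  by_contra! hv
  have key : ∀ (σ : Equiv.Perm N.HalfEdge) (h : N.HalfEdge),
      F N ident (σ (N.conn (σ.symm h))) = !F N ident h := by
    intro σ h
    have ha' : Admissible c Δ (N.permute σ) ident := ⟨ha.injective, ha.ident_lt, ha.deg_le⟩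
    have h1 : ∀ g : N.HalfEdge, F N ident g = F (N.permute σ) ident g := fun g =>
      hF N (N.permute σ) ident ident g.1 g.1 ha ha' ⟨rfl, rfl⟩ g.2 g.2 rfl
    rw [h1, h1]
    exact ho _ _ ha' h
  set h₁ : N.HalfEdge := ⟨v, ⟨0, by omega⟩⟩
  obtain ⟨h₃, -, h3⟩ := Finset.exists_mem_notMem_of_card_lt_card
    (s := ({h₁, N.conn h₁} : Finset N.HalfEdge))
    (t := Finset.univ.image fun k : Fin 3 => (⟨v, Fin.castLE hv k⟩ : N.HalfEdge)) (by
      rw [Finset.card_image_of_injective _ (fun k l hkl => by simpa using hkl)]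
      exact Finset.card_le_two.trans_lt (by simp))
  simp only [Finset.mem_insert, Finset.mem_singleton, not_or] at h3
  -- Any two of `h₁`, `N.conn h₁`, `h₃` form an edge in one of three rewired networks. Without
  -- communication the marks are the same in all of them, so three Boolean marks would have to
  -- differ pairwise.
  have k1 := key 1 h₁
  have k2 := key (Equiv.swap (N.conn h₁) h₃) h₁
  have k3 := key (Equiv.swap h₁ h₃) h₃
  rw [Equiv.symm_swap, Equiv.swap_apply_of_ne_of_ne (N.conn_ne _).symm (Ne.symm h3.1),
    Equiv.swap_apply_left] at k2
  rw [Equiv.symm_swap, Equiv.swap_apply_right,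
    Equiv.swap_apply_of_ne_of_ne (N.conn_ne _) (Ne.symm h3.2), k2, Bool.not_not] at k3
  change F N ident (N.conn h₁) = _ at k1
  rw [k3] at k1
  simp at k1

/-! ### Assembling the bounds -/

theorem exists_locality_le {c n Δ T : ℕ} {ε₁ ε₂ : ℝ} (h2 : 0 < ε₂) (h21 : ε₂ < ε₁)
    (h1 : ε₁ ≤ 1 / 6) (hT : Real.log n ≤ T)
    (hA : LocallySolvable c n Δ T fun d o => (1 / 2 - ε₁) * (d : ℝ) - 2 ≤ (o : ℝ)) :
    ∃ R : ℕ, (LocallySolvable c n Δ R fun d o => (1 / 2 - ε₂) * (d : ℝ) - 2 ≤ (o : ℝ)) ∧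
      (R : ℝ) ≤ 700 * ε₂ ^ (1 / Real.logb 2 (1 / 2 + ε₁)) * T := by
  -- For `T = 0` the bound leaves no rounds at all, but then every degree is at most 2 and the
  -- required outdegree is negative.
  rcases Nat.eq_zero_or_pos T with rfl | hT0
  · refine ⟨0, ?_, by simp⟩
    obtain ⟨F, hF, hF'⟩ := hA
    refine ⟨F, hF, fun N ident ha => ⟨(hF' N ident ha).1, fun v => ?_⟩⟩
    have h3 : N.deg v ≤ 2 := Nat.le_of_lt_succ
      (deg_lt_three_of_isLocal_zero hF (fun N ident ha => (hF' N ident ha).1) ha v)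
    have h4 : (N.deg v : ℝ) ≤ 2 := by exact_mod_cast h3
    have h5 := mul_nonneg h2.le (Nat.cast_nonneg (α := ℝ) (N.deg v))
    have h6 : (0 : ℝ) ≤ N.outdeg (F N ident) v := Nat.cast_nonneg _
    linarith
  · obtain ⟨i, hi1, hi2⟩ := exists_pow_le_and_two_pow_le h2 h21 h1
    have hr : 4 * n < 2 ^ (Nat.log 2 n + 3) := by
      have := Nat.lt_pow_succ_log_self (b := 2) (by norm_num) n
      rw [pow_succ] at this
      rw [pow_add]
      omega
    obtain ⟨R, hR, hR'⟩ := exists_iterate_halve (h2.trans h21) h1 hA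
      (locallySolvable_div_three c n Δ hr) i
    refine ⟨R, hR'.imp fun d o ⟨d', o', h3, h4, h5⟩ =>
      le_outdeg_of_iterate_halve h2 (h2.trans h21) hi1 h3 h4 h5, ?_⟩
    have hT1 : (1 : ℝ) ≤ T := by exact_mod_cast hT0
    have hlog : (Nat.log 2 n : ℝ) ≤ 2 * T := by
      refine (Real.natLog_le_logb n 2).trans ?_
      have h3 : 1 / 2 ≤ Real.log 2 := by linarith [Real.log_two_gt_d9]
      rw [Nat.cast_ofNat, Real.logb, div_le_iff₀ (by linarith)]
      nlinarith
    have hR2 : (R : ℝ) + T + 1 = 2 ^ i * (2 * (Nat.log 2 n + 3) + 2 + T + 1) := by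
      exact_mod_cast hR
    -- With `Nat.log 2 n ≤ 2 * T` and `1 ≤ T`, the bracket is at most `4 * T + 9 * T + T`; then `50
    -- * 14 = 700`.
    calc (R : ℝ) ≤ 2 ^ i * (2 * (Nat.log 2 n + 3) + 2 + T + 1) := by linarith
      _ ≤ 2 ^ i * (14 * T) := by gcongr; linarith
      _ ≤ 50 * ε₂ ^ (1 / Real.logb 2 (1 / 2 + ε₁)) * (14 * T) := by gcongr
      _ = _ := by ring

theorem mainTheorem5 (c : ℕ) (hc : 1 ≤ c) :
    ∃ C : ℝ, 0 < C ∧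
      ∀ (ε₁ ε₂ : ℕ → ℕ → ℝ) (T : ℕ → ℕ → ℕ) (A : LocalAlgorithm),
        (∀ n Δ, 0 < ε₂ n Δ ∧ ε₂ n Δ < ε₁ n Δ ∧ ε₁ n Δ ≤ 1 / 6) →
        (∀ n Δ : ℕ, Real.log (n : ℝ) ≤ (T n Δ : ℝ)) →
        A.ComputesWeakOrientation c (fun n Δ d => (1 / 2 - ε₁ n Δ) * (d : ℝ) - 2) T →
        ∃ (B : LocalAlgorithm) (T' : ℕ → ℕ → ℕ),
          B.ComputesWeakOrientation c (fun n Δ d => (1 / 2 - ε₂ n Δ) * (d : ℝ) - 2) T' ∧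
          ∀ n Δ : ℕ,
            (T' n Δ : ℝ) ≤ C * ε₂ n Δ ^ (1 / Real.logb 2 (1 / 2 + ε₁ n Δ)) * (T n Δ : ℝ) ∧
            (T' n Δ : ℝ) ≤ C * ε₂ n Δ ^ (-(1 + 24 * ε₁ n Δ)) * (T n Δ : ℝ) := by

  refine ⟨700, by norm_num, fun ε₁ ε₂ T A hε hT hA => ?_⟩
  choose T' hT' hle using fun n Δ => exists_locality_le (hε n Δ).1 (hε n Δ).2.1 (hε n Δ).2.2
    (hT n Δ) (hA.locallySolvable n Δ)
  obtain ⟨B, hB⟩ := exists_algorithm_of_locallySolvable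
    (k := fun n Δ d => (1 / 2 - ε₂ n Δ) * (d : ℝ) - 2) hT'
  refine ⟨B, T', hB, fun n Δ => ⟨hle n Δ, (hle n Δ).trans ?_⟩⟩
  have := rpow_inv_logb_le (hε n Δ).1 (hε n Δ).2.1 (hε n Δ).2.2
  gcongr
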